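/- A $k$-CNF formula is a finite conjunction of clauses, each of which is a disjunction of exactly $k$ distinct literals. A $(k,s)$-CNF formula is a $k$-CNF formula in which every variable occurs (negated or not) in at most $s$ clauses. A CNF formula is in $\mathrm{MU}(1)$ if it is unsatisfiable, becomes satisfiable when any one of its clauses is deleted, and has exactly one more clause than it has variables. For $k\ge 1$ let $f(k)$ be the largest integer $s$ such that every $(k,s)$-CNF formula is satisfiable, and let $f_1(k)$ be the largest integer $s$ such that no $(k,s)$-CNF formula is in $\mathrm{MU}(1)$. Theorem. Both maxima exist for every $k\ge 1$. For all $k\ge 1$, $$\left\lfloor\frac{2^{k+1}}{ek}\right\rfloor-1\le f(k),$$ and $$f(k)=\left(e^{-1}+O(k^{-1/2})\right)\frac{2^{k+1}}{k}.$$ Moreover, the upper bound is attained within $\mathrm{MU}(1)$: there is an absolute constant $C$ such that for every $k\ge 1$ some $(k,s)$-CNF formula with $s\le\left(e^{-1}+Ck^{-1/2}\right)\frac{2^{k+1}}{k}$ is in $\mathrm{MU}(1)$. In particular, $f(k)=(1+o(1))f_1(k)$ as $k\to\infty$. -/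

import Mathlib

namespace KSat

/-- A literal `(v, b)` over the variables `v : ℕ`: the variable `v` itself if `b = true`,
its negation if `b = false`. -/
abbrev Literal := ℕ × Bool

/-- A clause: the disjunction of a finite set of (distinct) literals. -/
abbrev Clause := Finset Literal

/-- A CNF formula: the conjunction of a finite set of clauses. -/
abbrev CNF := Finset Clause

/-- The variables that occur, negated or not, in a clause. -/
def Clause.vars (C : Clause) : Finset ℕ := C.image Prod.fst

/-- The variables that occur in a formula. -/
def CNF.vars (F : CNF) : Finset ℕ := F.biUnion Clause.vars

/-- A clause is satisfied by a truth assignment if one of its literals is true. -/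
def Clause.SatisfiedBy (C : Clause) (a : ℕ → Bool) : Prop := ∃ l ∈ C, a l.1 = l.2

/-- A formula is satisfiable if some truth assignment satisfies all its clauses. -/
def CNF.Satisfiable (F : CNF) : Prop := ∃ a : ℕ → Bool, ∀ C ∈ F, Clause.SatisfiedBy C a

/-- The number of clauses of `F` in which the variable `v` occurs, negated or not. -/
def CNF.occurrences (F : CNF) (v : ℕ) : ℕ := (F.filter (fun C => v ∈ Clause.vars C)).card

/-- A `k`-CNF formula: every clause has exactly `k` distinct literals. -/
def CNF.IsKCNF (k : ℕ) (F : CNF) : Prop := ∀ C ∈ F, C.card = k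

/-- A `(k, s)`-CNF formula: a `k`-CNF formula in which every variable occurs in at most
`s` clauses. -/
def CNF.IsKSCNF (k s : ℕ) (F : CNF) : Prop :=
  CNF.IsKCNF k F ∧ ∀ v : ℕ, CNF.occurrences F v ≤ s

/-- Minimal unsatisfiable formulas: unsatisfiable, but satisfiable after the deletion of any
one clause. -/
def CNF.IsMU (F : CNF) : Prop :=
  ¬ CNF.Satisfiable F ∧ ∀ C ∈ F, CNF.Satisfiable (F.erase C)

/-- The class MU(1): minimal unsatisfiable formulas with exactly one more clause than
variables. -/
def CNF.IsMU1 (F : CNF) : Prop := CNF.IsMU F ∧ F.card = (CNF.vars F).card + 1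

/-- The `s` for which every `(k, s)`-CNF formula is satisfiable. -/
def satSet (k : ℕ) : Set ℕ := {s | ∀ F : CNF, CNF.IsKSCNF k s F → CNF.Satisfiable F}

/-- The `s` for which no `(k, s)`-CNF formula is in MU(1). -/
def noMU1Set (k : ℕ) : Set ℕ := {s | ∀ F : CNF, CNF.IsKSCNF k s F → ¬ CNF.IsMU1 F}

/-- `f k` is the largest `s` such that every `(k, s)`-CNF formula is satisfiable. -/
noncomputable def f (k : ℕ) : ℕ := sSup (satSet k)

/-- `f₁ k` is the largest `s` such that no `(k, s)`-CNF formula is in MU(1). -/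
noncomputable def f₁ (k : ℕ) : ℕ := sSup (noMU1Set k)

end KSat

/-!
Lower bound. Assign the variables independently, making the literals that occur more often true
with a slightly larger probability. A clause shares variables with at most `k * s` others, but only
the clauses containing the complement of one of its literals have to be taken into account in the
lopsided form of the local lemma. The bias exactly compensates the uneven numbers of occurrences,
so that the condition of the lemma reduces to `e * k * (s + 1) ≤ 2 ^ (k + 1)`.

Upper bound (Gebauer, Szabó and Tardos). A full binary tree all of whose leaves have depth at least
`k` yields a formula in MU(1): the inner nodes are the variables, and the clause of a leaf consists
of the last `k` edges of the path to it. A variable occurs as often as its node sees leaves within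
distance `k`. Trees are built from vectors `x`, where `x i` bounds the number of leaves of depth
`i < k`: two vectors can be joined under a new root as soon as their leaves together fit into the
budget `d`, which shifts them by one level. The bulk of the leaves follows a profile whose density
grows by a factor `g` per block of `L` levels; letting `a` of the `2 ^ L` subtrees at depth `L`
carry a uniform tree replaces `g` by a smaller factor, at a cost that is affordable
because `e * ((n - 1) * x) ≤ (1 + x) ^ n`. Repeating this brings the growth from `1 + 128 / L` down
to `0`, that is, to a tree without leaves above depth `k`, with `d` of order `2 ^ (k + 1) / (e * k)`
up to a relative error of order `1 / L`, where `L` is of order `√k`.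
-/

namespace KSat

open Finset

section LocalLemma

open MeasureTheory

variable {Ω ι : Type*} {A : ι → Set Ω} {x : ι → ℝ}

/-- The event that none of the bad events `A i` with `i ∈ S` occurs. -/
def avoid (A : ι → Set Ω) (S : Finset ι) : Set Ω := ⋂ i ∈ S, (A i)ᶜ

lemma mem_avoid {S : Finset ι} {ω : Ω} : ω ∈ avoid A S ↔ ∀ i ∈ S, ω ∉ A i := by
  simp [avoid]

lemma avoid_anti {S T : Finset ι} (h : S ⊆ T) : avoid A T ⊆ avoid A S :=
  Set.biInter_subset_biInter_left h

lemma avoid_insert [DecidableEq ι] (S : Finset ι) (i : ι) :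
    avoid A (insert i S) = avoid A S \ A i := by
  rw [avoid, avoid, set_biInter_insert, Set.inter_comm, Set.sdiff_eq]

variable [MeasurableSpace Ω] {P : Measure Ω}

lemma measurableSet_avoid (hA : ∀ i, MeasurableSet (A i)) (S : Finset ι) :
    MeasurableSet (avoid A S) :=
  S.measurableSet_biInter fun i _ => (hA i).compl

lemma prod_mul_measureReal_avoid_le [DecidableEq ι] [IsFiniteMeasure P]
    (hA : ∀ i, MeasurableSet (A i)) (hx : ∀ i, x i ≤ 1) {S T : Finset ι} (hST : Disjoint S T)
    (h : ∀ U ⊂ S ∪ T, ∀ i ∈ T, P.real (avoid A U ∩ A i) ≤ x i * P.real (avoid A U)) :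
    (∏ i ∈ T, (1 - x i)) * P.real (avoid A S) ≤ P.real (avoid A (S ∪ T)) := by
  induction T using Finset.induction_on with
  | empty => simp
  | insert i T hi ih =>
    have hiU : i ∉ S ∪ T := by
      simp only [mem_union, hi, or_false]
      exact fun h => disjoint_left.1 hST h (mem_insert_self i T)
    have ih : (∏ j ∈ T, (1 - x j)) * P.real (avoid A S) ≤ P.real (avoid A (S ∪ T)) :=
      ih (hST.mono_right (subset_insert i T)) fun U hU j hj =>
        h U (hU.trans_subset (union_subset_union_right (subset_insert i T))) j
          (mem_insert_of_mem hj)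
    have hi' := h (S ∪ T) (union_insert i S T ▸ ssubset_insert hiU) i (mem_insert_self i T)
    rw [prod_insert hi, mul_assoc, union_insert, avoid_insert]
    calc (1 - x i) * ((∏ j ∈ T, (1 - x j)) * P.real (avoid A S))
        ≤ (1 - x i) * P.real (avoid A (S ∪ T)) :=
          mul_le_mul_of_nonneg_left ih (sub_nonneg.2 (hx i))
      _ ≤ P.real (avoid A (S ∪ T) \ A i) := by
          linarith [measureReal_inter_add_sdiff (μ := P) (s := avoid A (S ∪ T)) (hA i)]

lemma measureReal_avoid_inter_le [IsFiniteMeasure P] {s : Finset ι} {Γ : ι → Finset ι}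
    (hA : ∀ i, MeasurableSet (A i)) (hx0 : ∀ i, 0 ≤ x i) (hx1 : ∀ i, x i ≤ 1)
    (h : ∀ i ∈ s, ∀ S ⊆ s, Disjoint S (Γ i) →
      P.real (avoid A S ∩ A i) ≤ (x i * ∏ j ∈ Γ i, (1 - x j)) * P.real (avoid A S))
    (S : Finset ι) (hS : S ⊆ s) (i : ι) (hi : i ∈ s) :
    P.real (avoid A S ∩ A i) ≤ x i * P.real (avoid A S) := by
  classical
  induction S using Finset.strongInduction generalizing i with
  | H S ih =>
    have hdisj : Disjoint (S \ Γ i) (S ∩ Γ i) := disjoint_sdiff_inter S (Γ i)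
    have hunion : S \ Γ i ∪ S ∩ Γ i = S := sdiff_union_inter S (Γ i)
    have hprod : ∏ j ∈ Γ i, (1 - x j) ≤ ∏ j ∈ S ∩ Γ i, (1 - x j) :=
      prod_le_prod_of_subset_of_le_one inter_subset_right
        (fun j _ => sub_nonneg.2 (hx1 j)) fun j _ _ => sub_le_self 1 (hx0 j)
    have hchain : (∏ j ∈ S ∩ Γ i, (1 - x j)) * P.real (avoid A (S \ Γ i)) ≤
        P.real (avoid A S) := by
      have := prod_mul_measureReal_avoid_le (P := P) hA hx1 hdisj fun U hU j hj =>
        ih U (hunion ▸ hU) ((hunion ▸ hU.subset).trans hS) j (hS (mem_inter.1 hj).1)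
      rwa [hunion] at this
    calc P.real (avoid A S ∩ A i)
        ≤ P.real (avoid A (S \ Γ i) ∩ A i) :=
          measureReal_mono (Set.inter_subset_inter_left _ (avoid_anti sdiff_subset))
      _ ≤ (x i * ∏ j ∈ Γ i, (1 - x j)) * P.real (avoid A (S \ Γ i)) :=
          h i hi _ (sdiff_subset.trans hS) disjoint_sdiff_self_left
      _ ≤ (x i * ∏ j ∈ S ∩ Γ i, (1 - x j)) * P.real (avoid A (S \ Γ i)) := by
          gcongr
          exact hx0 i
      _ ≤ x i * P.real (avoid A S) := by
          rw [mul_assoc]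
          exact mul_le_mul_of_nonneg_left hchain (hx0 i)

theorem lopsided_local_lemma [IsProbabilityMeasure P] {s : Finset ι} {Γ : ι → Finset ι}
    (hA : ∀ i, MeasurableSet (A i)) (hx0 : ∀ i, 0 ≤ x i) (hx1 : ∀ i, x i ≤ 1)
    (h : ∀ i ∈ s, ∀ S ⊆ s, Disjoint S (Γ i) →
      P.real (avoid A S ∩ A i) ≤ (x i * ∏ j ∈ Γ i, (1 - x j)) * P.real (avoid A S)) :
    ∏ i ∈ s, (1 - x i) ≤ P.real (avoid A s) := by
  classical
  have := prod_mul_measureReal_avoid_le (P := P) hA hx1 (disjoint_empty_left s)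
    fun U hU i hi => measureReal_avoid_inter_le hA hx0 hx1 h U (empty_union s ▸ hU.subset) i hi
  simpa [avoid] using this

end LocalLemma

section Correlation

open MeasureTheory ProbabilityTheory Function

variable {ι : Type*} {X : ι → Type*} [∀ i, MeasurableSpace (X i)] [DecidableEq ι]
  {ν : ∀ i, Measure (X i)} [∀ i, IsProbabilityMeasure (ν i)]

lemma indepFun_eval_update (i : ι) (c : X i) :
    IndepFun (fun a : ∀ i, X i => a i) (fun a => update a i c) (Measure.infinitePi ν) := by
  let σ (j : ι) : MeasurableSpace (∀ i, X i) := MeasurableSpace.comap (fun a => a j) inferInstance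
  have hindep : Indep (⨆ j ∈ ({i} : Set ι), σ j) (⨆ j ∈ ({i}ᶜ : Set ι), σ j)
      (Measure.infinitePi ν) :=
    indep_biSup_compl (fun j => (measurable_pi_apply j).comap_le)
      (iIndepFun_infinitePi (P := ν) fun _ => measurable_id).iIndep {i}
  refine indep_of_indep_of_le_left (indep_of_indep_of_le_right hindep ?_)
    (le_biSup σ (Set.mem_singleton i))
  refine Measurable.comap_le ((@measurable_pi_iff _ _ _ (_) _ _).2 fun j => ?_)
  rcases eq_or_ne j i with rfl | hj
  · simp only [update_self, measurable_const]
  · simp only [update_of_ne hj]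
    exact (comap_measurable _).mono (le_biSup σ (Set.mem_compl_singleton_iff.2 hj)) le_rfl

/-- Harris' inequality for one coordinate: setting it to `c` never leaves `B`. -/
lemma measureReal_inter_ne_le {B : Set (∀ i, X i)} (hB : MeasurableSet B) {i : ι} {c : X i}
    (hc : MeasurableSet {c}) (hBc : ∀ a ∈ B, update a i c ∈ B) :
    (Measure.infinitePi ν).real (B ∩ {a | a i ≠ c}) ≤
      (ν i).real {c}ᶜ * (Measure.infinitePi ν).real B := by
  set P := Measure.infinitePi ν
  set B' : Set (∀ i, X i) := (fun a => update a i c) ⁻¹' B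
  have hmarginal (s : Set (X i)) (hs : MeasurableSet s) :
      P.real ((fun a => a i) ⁻¹' s ∩ B') = (ν i).real s * P.real B' := by
    rw [measureReal_def, (indepFun_eval_update i c).measure_inter_preimage_eq_mul _ _ hs hB,
      ENNReal.toReal_mul, ← Measure.map_apply (measurable_pi_apply i) hs,
      Measure.infinitePi_map_eval]
    rfl
  have hne : P.real (B ∩ {a | a i ≠ c}) ≤ (ν i).real {c}ᶜ * P.real B' := by
    rw [← hmarginal _ hc.compl]
    exact measureReal_mono fun a ha => ⟨ha.2, hBc a ha.1⟩
  have heq : P.real (B ∩ {a | a i = c}) = (ν i).real {c} * P.real B' := by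
    rw [← hmarginal _ hc, Set.inter_comm]
    congr 1
    ext a
    change a i = c ∧ a ∈ B ↔ a i = c ∧ update a i c ∈ B
    refine and_congr_right fun ha => ?_
    rw [← ha, update_eq_self]
  have hsplit : P.real (B ∩ {a | a i = c}) + P.real (B ∩ {a | a i ≠ c}) = P.real B :=
    measureReal_inter_add_sdiff (hc.preimage (measurable_pi_apply i))
  have hp : (ν i).real {c} + (ν i).real {c}ᶜ = 1 := probReal_add_probReal_compl hc
  calc P.real (B ∩ {a | a i ≠ c})
      = (ν i).real {c} * P.real (B ∩ {a | a i ≠ c}) +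
          (ν i).real {c}ᶜ * P.real (B ∩ {a | a i ≠ c}) := by rw [← add_mul, hp, one_mul]
    _ ≤ (ν i).real {c} * ((ν i).real {c}ᶜ * P.real B') +
          (ν i).real {c}ᶜ * P.real (B ∩ {a | a i ≠ c}) := by gcongr
    _ = (ν i).real {c}ᶜ * P.real B := by rw [← hsplit, heq]; ring

end Correlation

section Satisfiability

open MeasureTheory Function

/-- The event that a random truth assignment makes all literals of `C` false. -/
def Clause.falsifying (C : Clause) : Set (ℕ → Bool) := {a | ¬ Clause.SatisfiedBy C a}

/-- A clause without complementary literals; the other clauses are tautologies. -/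
def Clause.Consistent (C : Clause) : Prop := Set.InjOn Prod.fst (C : Set Literal)

/-- Two clauses conflict if some literal of the first is negated in the second; the conflicting
clauses are the neighbours in the lopsided dependency graph. -/
def Clause.Conflicts (C D : Clause) : Prop := ∃ l ∈ C, (l.1, !l.2) ∈ D

lemma satisfiedBy_of_not_consistent {C : Clause} (hC : ¬ Clause.Consistent C) (a : ℕ → Bool) :
    Clause.SatisfiedBy C a := by
  simp only [Clause.Consistent, Set.InjOn, mem_coe] at hC
  push Not at hC
  obtain ⟨⟨v, b⟩, hl, ⟨w, c⟩, hm, rfl : v = w, hne⟩ := hC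
  by_cases hb : a v = b
  · exact ⟨_, hl, hb⟩
  · have hbc : b ≠ c := fun h => hne (h ▸ rfl)
    exact ⟨_, hm, (Bool.eq_not_of_ne hb).trans (Bool.eq_not_of_ne hbc.symm).symm⟩

lemma falsifying_insert (l : Literal) (C : Clause) :
    Clause.falsifying (insert l C) = Clause.falsifying C ∩ {a | a l.1 ≠ l.2} := by
  ext a
  simp only [Clause.falsifying, Clause.SatisfiedBy, Set.mem_ofPred_eq, exists_mem_insert,
    not_or, Set.mem_inter_iff, ne_eq]
  exact and_comm

lemma measurableSet_falsifying (C : Clause) : MeasurableSet (Clause.falsifying C) := by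
  induction C using Finset.induction_on with
  | empty => simp [Clause.falsifying, Clause.SatisfiedBy]
  | insert l C _ ih =>
    rw [falsifying_insert]
    exact ih.inter ((MeasurableSet.singleton l.2).preimage (measurable_pi_apply l.1)).compl

lemma update_mem_falsifying {C : Clause} {a : ℕ → Bool} {v : ℕ} (b : Bool)
    (hv : ∀ l ∈ C, l.1 ≠ v) (ha : a ∈ Clause.falsifying C) :
    update a v b ∈ Clause.falsifying C := by
  rintro ⟨l, hl, h⟩
  exact ha ⟨l, hl, by rwa [update_of_ne (hv l hl)] at h⟩

lemma update_notMem_falsifying {C : Clause} {a : ℕ → Bool} {l : Literal}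
    (hl : (l.1, !l.2) ∉ C) (ha : a ∉ Clause.falsifying C) :
    update a l.1 l.2 ∉ Clause.falsifying C := by
  simp only [Clause.falsifying, Set.mem_ofPred_eq, not_not] at ha ⊢
  obtain ⟨⟨v, b⟩, hm, h⟩ := ha
  refine ⟨(v, b), hm, ?_⟩
  rcases eq_or_ne v l.1 with rfl | hv
  · rw [update_self]
    by_contra hb
    exact hl (Bool.eq_not_of_ne (Ne.symm hb) ▸ hm)
  · rwa [update_of_ne hv]

variable {ν : ℕ → Measure Bool} [∀ v, IsProbabilityMeasure (ν v)]

lemma measureReal_inter_falsifying_le {B : Set (ℕ → Bool)} (hB : MeasurableSet B) {C : Clause}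
    (hBC : ∀ l ∈ C, ∀ a ∈ B, update a l.1 l.2 ∈ B) :
    (Measure.infinitePi ν).real (B ∩ Clause.falsifying C) ≤
      (∏ l ∈ C, (ν l.1).real {l.2}ᶜ) * (Measure.infinitePi ν).real B := by
  by_cases hC : Clause.Consistent C
  swap
  · have hempty : Clause.falsifying C = ∅ :=
      Set.eq_empty_of_forall_notMem fun a ha => ha (satisfiedBy_of_not_consistent hC a)
    rw [hempty, Set.inter_empty, measureReal_empty]
    positivity
  induction C using Finset.induction_on with
  | empty =>
    rw [prod_empty, one_mul]
    exact measureReal_mono Set.inter_subset_left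
  | insert l C hl ih =>
    have ih := ih (fun m hm => hBC m (mem_insert_of_mem hm))
      (hC.mono (coe_subset.2 (subset_insert l C)))
    have hlC : ∀ m ∈ C, m.1 ≠ l.1 := fun m hm h =>
      hl (hC (mem_insert_of_mem hm) (mem_insert_self l C) h ▸ hm)
    rw [falsifying_insert, ← Set.inter_assoc, prod_insert hl, mul_assoc]
    refine (measureReal_inter_ne_le (hB.inter (measurableSet_falsifying C))
      (MeasurableSet.singleton l.2) ?_).trans
      (mul_le_mul_of_nonneg_left ih measureReal_nonneg)
    exact fun a ha => ⟨hBC l (mem_insert_self l C) a ha.1, update_mem_falsifying l.2 hlC ha.2⟩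

open Classical in
theorem satisfiable_of_prod_le {F : CNF} {x : Clause → ℝ} (hx0 : ∀ C, 0 ≤ x C)
    (hx1 : ∀ C, x C < 1)
    (h : ∀ C ∈ F, ∏ l ∈ C, (ν l.1).real {l.2}ᶜ ≤
      x C * ∏ D ∈ F with Clause.Conflicts C D, (1 - x D)) : CNF.Satisfiable F := by
  have hlocal := lopsided_local_lemma (P := Measure.infinitePi ν) (s := F)
    (Γ := fun C => F.filter (Clause.Conflicts C)) measurableSet_falsifying hx0
    (fun C => (hx1 C).le) fun C hC S hS hdisj => by
      refine (measureReal_inter_falsifying_le (measurableSet_avoid measurableSet_falsifying S)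
        ?_).trans (mul_le_mul_of_nonneg_right (h C hC) measureReal_nonneg)
      intro l hl a ha
      rw [mem_avoid] at ha ⊢
      exact fun D hD => update_notMem_falsifying (fun hm =>
        disjoint_left.1 hdisj hD (mem_filter.2 ⟨hS hD, l, hl, hm⟩)) (ha D hD)
  obtain ⟨a, ha⟩ := nonempty_of_measureReal_ne_zero
    ((prod_pos fun C _ => sub_pos.2 (hx1 C)).trans_le hlocal).ne'
  exact ⟨a, fun C hC => not_not.1 (mem_avoid.1 ha C hC)⟩

end Satisfiability

section LowerBound

open MeasureTheory ProbabilityTheory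

/-- The number of clauses that contain the literal `l`. -/
def CNF.literalCount (F : CNF) (l : Literal) : ℕ := #{C ∈ F | l ∈ C}

open Classical in
lemma satisfiable_of_filter_consistent {F : CNF}
    (h : CNF.Satisfiable (F.filter Clause.Consistent)) : CNF.Satisfiable F := by
  obtain ⟨a, ha⟩ := h
  refine ⟨a, fun C hC => ?_⟩
  by_cases hC' : Clause.Consistent C
  · exact ha C (mem_filter.2 ⟨hC, hC'⟩)
  · exact satisfiedBy_of_not_consistent hC' a

lemma occurrences_mono {F G : CNF} (h : F ⊆ G) (v : ℕ) :
    CNF.occurrences F v ≤ CNF.occurrences G v := card_le_card (filter_subset_filter _ h)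

lemma literalCount_add_literalCount_le {F : CNF} (hF : ∀ C ∈ F, Clause.Consistent C) (v : ℕ) :
    CNF.literalCount F (v, true) + CNF.literalCount F (v, false) ≤ CNF.occurrences F v := by
  rw [CNF.literalCount, CNF.literalCount, ← card_union_of_disjoint]
  · refine card_le_card (union_subset ?_ ?_) <;>
      exact monotone_filter_right F fun C _ hC => mem_image_of_mem Prod.fst hC
  · refine disjoint_filter.2 fun C hC ht hf => ?_
    simpa using hF C hC ht hf rfl

open Classical in
lemma card_conflicts_le (F : CNF) (C : Clause) :
    #{D ∈ F | Clause.Conflicts C D} ≤ ∑ l ∈ C, CNF.literalCount F (l.1, !l.2) := by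
  refine (card_le_card fun D hD => ?_).trans
    (card_biUnion_le (s := C) (t := fun l => {D ∈ F | (l.1, !l.2) ∈ D}))
  obtain ⟨hDF, l, hl, hlD⟩ := mem_filter.1 hD
  exact mem_biUnion.2 ⟨l, hl, mem_filter.2 ⟨hDF, hlD⟩⟩

/-- The bias `(c false - c true) * δ / 2` makes a literal less likely to be false the more often
its negation occurs. -/
lemma exists_biased_coin {s δ : ℝ} (hδ : 0 ≤ δ) (hδs : δ * s ≤ 1) {c : Bool → ℝ}
    (hc0 : ∀ b, 0 ≤ c b) (hc : c true + c false ≤ s) :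
    ∃ ν : Measure Bool, IsProbabilityMeasure ν ∧
      ∀ b, ν.real {b}ᶜ ≤ 1 / 2 * Real.exp (δ * s - 2 * δ * c (!b)) := by
  have hsum : δ * c true + δ * c false ≤ δ * s := by
    rw [← mul_add]
    exact mul_le_mul_of_nonneg_left hc hδ
  have ht : 0 ≤ δ * c true := mul_nonneg hδ (hc0 true)
  have hf : 0 ≤ δ * c false := mul_nonneg hδ (hc0 false)
  let p : unitInterval := ⟨(1 + δ * c false - δ * c true) / 2, by constructor <;> linarith⟩
  refine ⟨bernoulliMeasure true false p, inferInstance, fun b => ?_⟩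
  have hb : (bernoulliMeasure true false p).real {b}ᶜ ≤
      1 / 2 * (δ * s - 2 * δ * c (!b) + 1) := by
    rw [bernoulliMeasure_real_apply p (MeasurableSet.singleton b).compl]
    cases b <;> simp [p] <;> linarith
  exact hb.trans (mul_le_mul_of_nonneg_left (Real.add_one_le_exp _) (by norm_num))

lemma exp_neg_le_one_sub {x y : ℝ} (hy : 0 ≤ y) (h : x * (1 + y) ≤ y) :
    Real.exp (-y) ≤ 1 - x := by
  rw [Real.exp_neg]
  calc (Real.exp y)⁻¹ ≤ (1 + y)⁻¹ := by
        gcongr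
        linarith [Real.add_one_le_exp y]
    _ ≤ 1 - x := by
        rw [inv_le_iff_one_le_mul₀ (by positivity)]
        linarith

lemma prod_half_mul_exp {k : ℕ} {δ s : ℝ} {C : Clause} (hC : #C = k) (hδ : k * (δ * s) = 1)
    (n : Literal → ℕ) :
    ∏ l ∈ C, (1 / 2 * Real.exp (δ * s - 2 * δ * n l)) =
      Real.exp 1 / 2 ^ k * Real.exp (-(2 * δ)) ^ ∑ l ∈ C, n l := by
  have hsum : ∑ l ∈ C, (δ * s - 2 * δ * n l) = 1 + (∑ l ∈ C, n l : ℕ) * -(2 * δ) := by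
    rw [sum_sub_distrib, sum_const, hC, nsmul_eq_mul, hδ, ← mul_sum, Nat.cast_sum]
    ring
  rw [prod_mul_distrib, prod_const, hC, ← Real.exp_sum, hsum, Real.exp_add, Real.exp_nat_mul,
    one_div, inv_pow]
  ring

lemma exp_div_two_pow_mul_le {k s : ℕ} (hk : 2 ≤ k) (hs : 1 ≤ s)
    (h : ((s : ℝ) + 1) * (Real.exp 1 * k) ≤ 2 ^ (k + 1)) :
    Real.exp 1 / 2 ^ k * (1 + 2 * (1 / (k * s))) ≤ 2 * (1 / (k * s) : ℝ) := by
  have hk2 : (2 : ℝ) ≤ k := by exact_mod_cast hk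
  have hks : (0 : ℝ) < k * s := by positivity
  have he : Real.exp 1 * (k * s + 2) ≤ 2 ^ k * 2 := by
    rw [← pow_succ]
    refine le_trans ?_ h
    nlinarith [Real.exp_pos 1]
  rw [mul_one_div, show 1 + 2 / (k * s : ℝ) = (k * s + 2) / (k * s) by field_simp,
    div_mul_div_comm, div_le_div_iff₀ (by positivity) hks]
  nlinarith

lemma satisfiable_of_literalCount_le {k s : ℕ} (hk : 2 ≤ k) (hs : 1 ≤ s)
    (h : ((s : ℝ) + 1) * (Real.exp 1 * k) ≤ 2 ^ (k + 1)) {F : CNF} (hF : CNF.IsKCNF k F)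
    (hcount : ∀ v, CNF.literalCount F (v, true) + CNF.literalCount F (v, false) ≤ s) :
    CNF.Satisfiable F := by
  classical
  set δ : ℝ := 1 / (k * s) with hδ
  have hδ0 : 0 < δ := by positivity
  have hkδs : k * (δ * s) = 1 := by rw [hδ]; field_simp
  have hδs : δ * s ≤ 1 := by
    have hk1 : (1 : ℝ) ≤ k := by exact_mod_cast hk.trans' one_le_two
    nlinarith [mul_nonneg hδ0.le (Nat.cast_nonneg (α := ℝ) s)]
  choose ν hν hνb using fun v => exists_biased_coin hδ0.le hδs
    (c := fun b => CNF.literalCount F (v, b)) (fun b => Nat.cast_nonneg _)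
    (by exact_mod_cast hcount v)
  set x : ℝ := Real.exp 1 / 2 ^ k
  have hx0 : 0 ≤ x := by positivity
  have hexp : Real.exp (-(2 * δ)) ≤ 1 - x :=
    exp_neg_le_one_sub (by positivity) (exp_div_two_pow_mul_le hk hs h)
  have hx1 : x < 1 := sub_pos.1 ((Real.exp_pos _).trans_le hexp)
  refine satisfiable_of_prod_le (ν := ν) (x := fun _ => x) (fun _ => hx0) (fun _ => hx1)
    fun C hC => ?_
  calc ∏ l ∈ C, (ν l.1).real {l.2}ᶜ
      ≤ ∏ l ∈ C, (1 / 2 * Real.exp (δ * s - 2 * δ * CNF.literalCount F (l.1, !l.2))) :=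
        prod_le_prod (fun _ _ => measureReal_nonneg) fun l _ => hνb l.1 l.2
    _ = x * Real.exp (-(2 * δ)) ^ ∑ l ∈ C, CNF.literalCount F (l.1, !l.2) :=
        prod_half_mul_exp (hF C hC) hkδs fun l => CNF.literalCount F (l.1, !l.2)
    _ ≤ x * (1 - x) ^ ∑ l ∈ C, CNF.literalCount F (l.1, !l.2) := by gcongr
    _ ≤ x * ∏ D ∈ F with Clause.Conflicts C D, (1 - x) := by
        rw [prod_const]
        exact mul_le_mul_of_nonneg_left (pow_le_pow_of_le_one (sub_nonneg.2 hx1.le)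
          (sub_le_self 1 hx0) (card_conflicts_le F C)) hx0

theorem satisfiable_of_occurrences_le {k s : ℕ} (hk : 2 ≤ k) (hs : 1 ≤ s)
    (h : ((s : ℝ) + 1) * (Real.exp 1 * k) ≤ 2 ^ (k + 1)) {F : CNF} (hF : CNF.IsKSCNF k s F) :
    CNF.Satisfiable F := by
  classical
  refine satisfiable_of_filter_consistent (satisfiable_of_literalCount_le hk hs h
    (fun C hC => hF.1 C (filter_subset _ _ hC)) fun v => ?_)
  exact (literalCount_add_literalCount_le (fun C hC => (mem_filter.1 hC).2) v).trans
    ((occurrences_mono (filter_subset _ _) v).trans (hF.2 v))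

end LowerBound

section Suffix

variable {α : Type*} {b b' : α} {p q l : List α}

lemma not_cons_suffix_self : ¬ b :: p <:+ p := fun h => by
  simpa using h.length_le

lemma eq_of_cons_suffix (h : b :: p <:+ l) (h' : b' :: p <:+ l) : b = b' :=
  (List.cons.inj ((List.suffix_of_suffix_length_le h h' le_rfl).eq_of_length rfl)).1

lemma eq_or_cons_suffix (hpq : p <:+ q) (hpl : b :: p <:+ l) (hql : q <:+ l) :
    q = p ∨ b :: p <:+ q := by
  rcases hpq.length_le.eq_or_lt with h | h
  · exact Or.inl (hpq.eq_of_length h).symm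
  · exact Or.inr (List.suffix_of_suffix_length_le hpl hql h)

end Suffix

/-- Full binary trees, whose leaves will be the clauses and whose inner nodes the variables of a
formula; the children of an inner node are indexed by `Bool`. -/
inductive BTree where
  | leaf : BTree
  | node : (Bool → BTree) → BTree

namespace BTree

/-- The number of leaves at depth `i`. -/
def leafCount : BTree → ℕ → ℕ
  | leaf, 0 => 1
  | leaf, _ + 1 => 0
  | node _, 0 => 0
  | node c, i + 1 => ∑ b, leafCount (c b) i

/-- The trees that become formulas with clauses of size `k` and at most `d` occurrences per
variable: below every inner node there are at most `d` leaves within distance `k`, and each of its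
children has a leaf at distance less than `k`. -/
def Admissible (k d : ℕ) : BTree → Prop
  | leaf => True
  | node c => (∀ b, Admissible k d (c b) ∧ ∃ i < k, leafCount (c b) i ≠ 0) ∧
      ∑ b, ∑ i ∈ range k, leafCount (c b) i ≤ d

/-- The addresses of the leaves of a tree whose root has address `p`. An address lists the
directions of the edges on the path to the node, the last edge first, so that ancestors are
suffixes. -/
def leaves : BTree → List Bool → Finset (List Bool)
  | leaf, p => {p}
  | node c, p => univ.biUnion fun b => leaves (c b) (b :: p)

/-- The addresses of the inner nodes of a tree whose root has address `p`. -/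
def inner : BTree → List Bool → Finset (List Bool)
  | leaf, _ => ∅
  | node c, p => insert p (univ.biUnion fun b => inner (c b) (b :: p))

variable {T : BTree} {c : Bool → BTree} {k d : ℕ} {p q l : List Bool}

lemma mem_leaves_leaf : l ∈ leaf.leaves p ↔ l = p := mem_singleton

lemma mem_leaves_node : l ∈ (node c).leaves p ↔ ∃ b, l ∈ (c b).leaves (b :: p) := by
  simp only [leaves, mem_biUnion, mem_univ, true_and]

lemma mem_inner_node : q ∈ (node c).inner p ↔ q = p ∨ ∃ b, q ∈ (c b).inner (b :: p) := by
  simp only [inner, mem_insert, mem_biUnion, mem_univ, true_and]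

lemma suffix_of_mem_leaves (h : l ∈ T.leaves p) : p <:+ l := by
  induction T generalizing p with
  | leaf => exact (mem_leaves_leaf.1 h) ▸ List.suffix_rfl
  | node c ih =>
    obtain ⟨b, hb⟩ := mem_leaves_node.1 h
    exact (List.suffix_cons b p).trans (ih b hb)

lemma suffix_of_mem_inner (h : q ∈ T.inner p) : p <:+ q := by
  induction T generalizing p with
  | leaf => simp [inner] at h
  | node c ih =>
    rcases mem_inner_node.1 h with rfl | ⟨b, hb⟩
    · exact List.suffix_rfl
    · exact (List.suffix_cons b p).trans (ih b hb)

lemma pairwiseDisjoint_of_suffix {s : Bool → Finset (List Bool)}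
    (hs : ∀ b, ∀ l ∈ s b, b :: p <:+ l) :
    (↑(univ : Finset Bool) : Set Bool).PairwiseDisjoint s :=
  fun b _ b' _ hne => disjoint_left.2 fun l hl hl' =>
    hne (eq_of_cons_suffix (hs b l hl) (hs b' l hl'))

lemma card_leaves (T : BTree) (p : List Bool) : #(T.leaves p) = #(T.inner p) + 1 := by
  induction T generalizing p with
  | leaf => rfl
  | node c ih =>
    have hroot : p ∉ univ.biUnion fun b => (c b).inner (b :: p) := by
      simp only [mem_biUnion, mem_univ, true_and, not_exists]
      exact fun b hb => not_cons_suffix_self (suffix_of_mem_inner hb)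
    rw [leaves, inner, card_insert_of_notMem hroot,
      card_biUnion (pairwiseDisjoint_of_suffix fun b l => suffix_of_mem_leaves),
      card_biUnion (pairwiseDisjoint_of_suffix fun b l => suffix_of_mem_inner)]
    simp only [ih, Fintype.sum_bool]
    ring

lemma card_filter_length_eq (T : BTree) (p : List Bool) (i : ℕ) :
    #{l ∈ T.leaves p | l.length = p.length + i} = T.leafCount i := by
  induction T generalizing p i with
  | leaf => cases i <;> simp [leaves, leafCount, filter_singleton]
  | node c ih =>
    rw [leaves, filter_biUnion, card_biUnion (pairwiseDisjoint_of_suffix fun b l hl =>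
      suffix_of_mem_leaves (mem_filter.1 hl).1)]
    cases i with
    | zero =>
      refine sum_eq_zero fun b _ => card_eq_zero.2 (filter_eq_empty_iff.2 fun l hl h => ?_)
      have := (suffix_of_mem_leaves hl).length_le
      rw [List.length_cons] at this
      omega
    | succ i =>
      refine sum_congr rfl fun b _ => ?_
      rw [← ih b (b :: p) i, List.length_cons, add_right_comm, add_assoc]

lemma card_filter_length_lt (T : BTree) (p : List Bool) (k : ℕ) :
    #{l ∈ T.leaves p | l.length < p.length + k} = ∑ i ∈ range k, T.leafCount i := by
  rw [card_eq_sum_card_fiberwise (f := fun l => l.length - p.length) (t := range k)]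
  · refine sum_congr rfl fun i hi => ?_
    rw [← card_filter_length_eq T p i, filter_filter]
    refine congrArg card (filter_congr fun l hl => ?_)
    have := (suffix_of_mem_leaves hl).length_le
    have := mem_range.1 hi
    omega
  · intro l hl
    obtain ⟨hl, hlen⟩ := mem_filter.1 (mem_coe.1 hl)
    have := (suffix_of_mem_leaves hl).length_le
    exact mem_coe.2 (mem_range.2 (show l.length - p.length < k by omega))

/-- The edge in direction `b` below the inner node `q` is among the last `k` edges on the path
to `l`; it will be one of the literals of the clause of the leaf `l`. -/
def Sees (k : ℕ) (l q : List Bool) (b : Bool) : Prop := b :: q <:+ l ∧ l.length ≤ q.length + k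

lemma exists_cons_suffix_of_length_lt (h : p <:+ q) (hlen : p.length < q.length) :
    ∃ b, b :: p <:+ q := by
  obtain ⟨t, rfl⟩ := h
  rcases List.eq_nil_or_concat t with rfl | ⟨t, b, rfl⟩
  · exact absurd hlen (lt_irrefl _)
  · exact ⟨b, t, by simp⟩

open Classical in
lemma card_sees_le (hT : T.Admissible k d) (hpq : p <:+ q) :
    #{l ∈ T.leaves p | ∃ b, Sees k l q b} ≤ d := by
  induction T generalizing p with
  | leaf =>
    rw [card_eq_zero.2 (filter_eq_empty_iff.2 _)]
    · exact Nat.zero_le d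
    · rintro l hl ⟨b, hb, -⟩
      rw [mem_leaves_leaf.1 hl] at hb
      exact not_cons_suffix_self (hb.trans hpq)
  | node c ih =>
    rw [Admissible] at hT
    rcases hpq.length_le.eq_or_lt with hlen | hlen
    · obtain rfl := hpq.eq_of_length hlen
      simp_rw [← fun b => card_filter_length_lt (c b) (b :: p)] at hT
      refine le_trans ((card_le_card fun l hl => ?_).trans card_biUnion_le) hT.2
      obtain ⟨hl, b', -, hlen⟩ := mem_filter.1 hl
      obtain ⟨b, hb⟩ := mem_leaves_node.1 hl
      exact mem_biUnion.2 ⟨b, mem_univ b, mem_filter.2 ⟨hb, by rw [List.length_cons]; omega⟩⟩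
    · obtain ⟨b, hb⟩ := exists_cons_suffix_of_length_lt hpq hlen
      refine (card_le_card fun l hl => ?_).trans (ih b (hT.1 b).1 hb)
      obtain ⟨hl, b', hsees⟩ := mem_filter.1 hl
      obtain ⟨b'', hl⟩ := mem_leaves_node.1 hl
      have hbl : b :: p <:+ l := hb.trans ((List.suffix_cons b' q).trans hsees.1)
      obtain rfl := eq_of_cons_suffix hbl (suffix_of_mem_leaves hl)
      exact mem_filter.2 ⟨hl, b', hsees⟩

lemma exists_sees_of_leafCount_ne_zero (b : Bool) (h : ∃ i < k, T.leafCount i ≠ 0) :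
    ∃ l ∈ T.leaves (b :: p), Sees k l p b := by
  obtain ⟨i, hi, h⟩ := h
  rw [← card_filter_length_eq T (b :: p) i, card_ne_zero] at h
  obtain ⟨l, hl⟩ := h
  obtain ⟨hl, hlen⟩ := mem_filter.1 hl
  rw [List.length_cons] at hlen
  exact ⟨l, hl, suffix_of_mem_leaves hl, by omega⟩

lemma exists_sees_of_mem_inner (hT : T.Admissible k d) (hq : q ∈ T.inner p) :
    ∃ l ∈ T.leaves p, ∃ b, Sees k l q b := by
  induction T generalizing p with
  | leaf => simp [inner] at hq
  | node c ih =>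
    rw [Admissible] at hT
    rcases mem_inner_node.1 hq with rfl | ⟨b, hb⟩
    · obtain ⟨l, hl, hsees⟩ := exists_sees_of_leafCount_ne_zero true (hT.1 true).2
      exact ⟨l, mem_leaves_node.2 ⟨true, hl⟩, true, hsees⟩
    · obtain ⟨l, hl, hsees⟩ := ih b (hT.1 b).1 hb
      exact ⟨l, mem_leaves_node.2 ⟨b, hl⟩, hsees⟩

lemma mem_inner_of_suffix {b : Bool} (hl : l ∈ T.leaves p) (hpq : p <:+ q) (hq : b :: q <:+ l) :
    q ∈ T.inner p := by
  induction T generalizing p with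
  | leaf =>
    rw [mem_leaves_leaf.1 hl] at hq
    exact absurd (hq.trans hpq) not_cons_suffix_self
  | node c ih =>
    obtain ⟨b', hb'⟩ := mem_leaves_node.1 hl
    exact mem_inner_node.2 <| (eq_or_cons_suffix hpq (suffix_of_mem_leaves hb')
      ((List.suffix_cons b q).trans hq)).imp_right fun h => ⟨b', ih b' hb' h⟩

lemma exists_leaf_falsified (T : BTree) (p : List Bool) (a : List Bool → Bool) :
    ∃ l ∈ T.leaves p, ∀ q b, p <:+ q → b :: q <:+ l → a q ≠ b := by
  induction T generalizing p with
  | leaf =>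
    exact ⟨p, mem_leaves_leaf.2 rfl, fun q b h h' => absurd (h'.trans h) not_cons_suffix_self⟩
  | node c ih =>
    obtain ⟨l, hl, h⟩ := ih (!a p) ((!a p) :: p)
    refine ⟨l, mem_leaves_node.2 ⟨_, hl⟩, fun q b hpq hq => ?_⟩
    rcases eq_or_cons_suffix hpq (suffix_of_mem_leaves hl) ((List.suffix_cons b q).trans hq)
      with rfl | hq'
    · rw [← eq_of_cons_suffix (suffix_of_mem_leaves hl) hq]
      exact (Bool.not_ne_self _).symm
    · exact h q b hq' hq

/- Below the child containing `l₀` take the assignment given by induction; make the root satisfy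
the other child, except for the leaves whose clauses do not reach up to the root. Those are
satisfied by the assignment, given by induction, that spares a leaf whose clause does. -/
lemma exists_assignment_erase {l₀ : List Bool} (hT : T.Admissible k d) (hl₀ : l₀ ∈ T.leaves p) :
    ∃ a : List Bool → Bool, ∀ l ∈ T.leaves p, l ≠ l₀ →
      ∃ q, p <:+ q ∧ Sees k l q (a q) := by
  induction T generalizing p l₀ with
  | leaf => exact ⟨fun _ => true, fun l hl hne =>
      absurd ((mem_leaves_leaf.1 hl).trans (mem_leaves_leaf.1 hl₀).symm) hne⟩
  | node c ih =>
    rw [Admissible] at hT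
    obtain ⟨b₀, hb₀⟩ := mem_leaves_node.1 hl₀
    obtain ⟨a₁, ha₁⟩ := ih b₀ (hT.1 b₀).1 hb₀
    obtain ⟨l₁, hl₁, hsees₁⟩ := exists_sees_of_leafCount_ne_zero (p := p) (!b₀) (hT.1 (!b₀)).2
    obtain ⟨a₂, ha₂⟩ := ih (!b₀) (hT.1 (!b₀)).1 hl₁
    classical
    refine ⟨fun q => if q = p then !b₀ else if b₀ :: p <:+ q then a₁ q else a₂ q,
      fun l hl hne => ?_⟩
    have ne_root {b q} (h : b :: p <:+ q) : q ≠ p := by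
      rintro rfl
      exact not_cons_suffix_self h
    obtain ⟨b, hb⟩ := mem_leaves_node.1 hl
    obtain rfl | rfl := Bool.eq_or_eq_not b b₀
    · obtain ⟨q, hq, hsees⟩ := ha₁ l hb hne
      exact ⟨q, (List.suffix_cons b p).trans hq, by simpa only [if_neg (ne_root hq), if_pos hq]⟩
    · by_cases hl₁ : l = l₁
      · exact ⟨p, List.suffix_rfl, by simpa only [if_pos, hl₁]⟩
      · obtain ⟨q, hq, hsees⟩ := ha₂ l hb hl₁
        have hq' : ¬ b₀ :: p <:+ q := fun h => Bool.not_ne_self b₀ (eq_of_cons_suffix hq h)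
        exact ⟨q, (List.suffix_cons _ p).trans hq,
          by simpa only [if_neg (ne_root hq), if_neg hq']⟩

end BTree

section TreeFormula

open BTree

variable {k d v : ℕ} {l l' : List Bool} {T : BTree}

/-- The clause of the leaf with address `l`, formed by the last `k` edges on the path to it. The
edge in direction `b` below the inner node `q` becomes the literal with sign `b` of the variable
that encodes `q`. -/
def pathClause : ℕ → List Bool → Clause
  | 0, _ => ∅
  | _ + 1, [] => ∅
  | k + 1, b :: l => insert (Encodable.encode l, b) (pathClause k l)

lemma mem_pathClause {x : Literal} :
    x ∈ pathClause k l ↔ ∃ q, Encodable.encode q = x.1 ∧ Sees k l q x.2 := by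
  induction k generalizing l with
  | zero =>
    refine iff_of_false (notMem_empty x) ?_
    rintro ⟨q, -, hq, hlen⟩
    exact absurd hq.length_le (not_le.2 (Nat.lt_succ_of_le hlen))
  | succ k ih =>
    cases l with
    | nil =>
      refine iff_of_false (notMem_empty x) ?_
      rintro ⟨q, -, hq, -⟩
      exact List.cons_ne_nil _ _ (List.suffix_nil.1 hq)
    | cons b l =>
      rw [pathClause, mem_insert, ih]
      constructor
      · rintro (rfl | ⟨q, hqx, hq, hlen⟩)
        · exact ⟨l, rfl, List.suffix_rfl, by rw [List.length_cons]; omega⟩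
        · exact ⟨q, hqx, hq.trans (List.suffix_cons b l), by rw [List.length_cons]; omega⟩
      · rintro ⟨q, hqx, hq, hlen⟩
        rw [List.length_cons] at hlen
        rcases List.suffix_cons_iff.1 hq with hq | hq
        · obtain ⟨hb, rfl⟩ := List.cons.inj hq
          exact Or.inl (Prod.ext hqx.symm hb)
        · exact Or.inr ⟨q, hqx, hq, by omega⟩

lemma encode_mem_pathClause {q : List Bool} {b : Bool} :
    (Encodable.encode q, b) ∈ pathClause k l ↔ Sees k l q b := by
  simp [mem_pathClause]

lemma mem_vars_pathClause :
    v ∈ Clause.vars (pathClause k l) ↔ ∃ q, Encodable.encode q = v ∧ ∃ b, Sees k l q b := by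
  simp only [Clause.vars, mem_image, mem_pathClause, Prod.exists, exists_and_right,
    exists_eq_right]
  rw [exists_comm]
  simp only [exists_and_left]

lemma card_pathClause (h : k ≤ l.length) : #(pathClause k l) = k := by
  induction k generalizing l with
  | zero => rfl
  | succ k ih =>
    cases l with
    | nil => simp at h
    | cons b l =>
      rw [pathClause, card_insert_of_notMem, ih (Nat.le_of_succ_le_succ h)]
      exact fun hmem => not_cons_suffix_self (encode_mem_pathClause.1 hmem).1

lemma suffix_of_pathClause_eq (hk : 1 ≤ k) (h : pathClause k l = pathClause k l') :
    l <:+ l' := by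
  cases l with
  | nil => exact List.nil_suffix
  | cons b l =>
    have hmem : (Encodable.encode l, b) ∈ pathClause k (b :: l) :=
      encode_mem_pathClause.2 ⟨List.suffix_rfl, by rw [List.length_cons]; omega⟩
    exact (encode_mem_pathClause.1 (h ▸ hmem)).1

lemma pathClause_injective (hk : 1 ≤ k) : Function.Injective (pathClause k) := fun _ _ h =>
  (suffix_of_pathClause_eq hk h).eq_of_length_le (suffix_of_pathClause_eq hk h.symm).length_le

/-- The formula of a tree: one clause for each leaf. -/
def treeFormula (k : ℕ) (T : BTree) : CNF := (T.leaves []).image (pathClause k)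

lemma le_length_of_mem_leaves (h0 : ∀ i < k, T.leafCount i = 0) (hl : l ∈ T.leaves []) :
    k ≤ l.length := by
  by_contra! hlt
  exact card_ne_zero_of_mem (mem_filter.2 ⟨hl, (Nat.zero_add _).symm⟩)
    ((card_filter_length_eq T [] l.length).trans (h0 _ hlt))

lemma isKCNF_treeFormula (h0 : ∀ i < k, T.leafCount i = 0) :
    CNF.IsKCNF k (treeFormula k T) := fun C hC => by
  obtain ⟨l, hl, rfl⟩ := mem_image.1 hC
  exact card_pathClause (le_length_of_mem_leaves h0 hl)

lemma occurrences_treeFormula_le (hT : T.Admissible k d) (v : ℕ) :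
    CNF.occurrences (treeFormula k T) v ≤ d := by
  classical
  rw [CNF.occurrences, treeFormula, filter_image]
  refine card_image_le.trans ?_
  by_cases hv : ∃ q : List Bool, Encodable.encode q = v
  · obtain ⟨q, rfl⟩ := hv
    refine (card_le_card fun l hl => ?_).trans (card_sees_le hT (q := q) List.nil_suffix)
    obtain ⟨hl, hmem⟩ := mem_filter.1 hl
    obtain ⟨q', hq, hsees⟩ := mem_vars_pathClause.1 hmem
    rw [Encodable.encode_injective hq] at hsees
    exact mem_filter.2 ⟨hl, hsees⟩
  · rw [filter_eq_empty_iff.2 fun l _ hmem => ?_, card_empty]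
    · exact Nat.zero_le d
    · obtain ⟨q, hq, -⟩ := mem_vars_pathClause.1 hmem
      exact hv ⟨q, hq⟩

lemma not_satisfiable_treeFormula (k : ℕ) (T : BTree) :
    ¬ CNF.Satisfiable (treeFormula k T) := by
  rintro ⟨a, ha⟩
  obtain ⟨l, hl, hfalse⟩ := exists_leaf_falsified T [] fun q => a (Encodable.encode q)
  obtain ⟨x, hx, hxa⟩ := ha _ (mem_image_of_mem _ hl)
  obtain ⟨q, hqx, hq, -⟩ := mem_pathClause.1 hx
  exact hfalse q x.2 List.nil_suffix hq (by rw [hqx, hxa])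

lemma satisfiable_erase_treeFormula (hT : T.Admissible k d) {C : Clause}
    (hC : C ∈ treeFormula k T) : CNF.Satisfiable ((treeFormula k T).erase C) := by
  obtain ⟨l₀, hl₀, rfl⟩ := mem_image.1 hC
  obtain ⟨a, ha⟩ := exists_assignment_erase hT hl₀
  refine ⟨fun v => (Encodable.decode v).elim true a, fun C hC => ?_⟩
  obtain ⟨hne, hC⟩ := mem_erase.1 hC
  obtain ⟨l, hl, rfl⟩ := mem_image.1 hC
  obtain ⟨q, -, hsees⟩ := ha l hl (ne_of_apply_ne _ hne)
  exact ⟨(Encodable.encode q, a q), encode_mem_pathClause.2 hsees, by simp⟩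

lemma vars_treeFormula (hT : T.Admissible k d) :
    CNF.vars (treeFormula k T) = (T.inner []).image Encodable.encode := by
  ext v
  simp only [CNF.vars, treeFormula, mem_biUnion, mem_image, exists_exists_and_eq_and,
    mem_vars_pathClause]
  constructor
  · rintro ⟨l, hl, q, rfl, b, hsees⟩
    exact ⟨q, mem_inner_of_suffix hl List.nil_suffix hsees.1, rfl⟩
  · rintro ⟨q, hq, rfl⟩
    obtain ⟨l, hl, hsees⟩ := exists_sees_of_mem_inner hT hq
    exact ⟨l, hl, q, rfl, hsees⟩

lemma isKSCNF_treeFormula (hT : T.Admissible k d) (h0 : ∀ i < k, T.leafCount i = 0) :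
    CNF.IsKSCNF k d (treeFormula k T) :=
  ⟨isKCNF_treeFormula h0, occurrences_treeFormula_le hT⟩

lemma isMU1_treeFormula (hk : 1 ≤ k) (hT : T.Admissible k d) : CNF.IsMU1 (treeFormula k T) := by
  refine ⟨⟨not_satisfiable_treeFormula k T, fun C => satisfiable_erase_treeFormula hT⟩, ?_⟩
  rw [vars_treeFormula hT, card_image_of_injective _ Encodable.encode_injective, treeFormula,
    card_image_of_injective _ (pathClause_injective hk), card_leaves]

end TreeFormula

open BTree in
/-- The vectors `x` for which some admissible tree has at most `x i` leaves at every depth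
`i < k`. If `x = 0`, all leaves of such a tree have depth at least `k`, so it gives a formula. -/
def Realizable (k d : ℕ) (x : ℕ → ℕ) : Prop :=
  ∃ T : BTree, T.Admissible k d ∧ ∀ i < k, T.leafCount i ≤ x i

section Realizable

open BTree

variable {k d : ℕ} {x y : ℕ → ℕ}

lemma exists_formula_of_realizable_zero (hk : 1 ≤ k) (h : Realizable k d 0) :
    ∃ F : CNF, CNF.IsKSCNF k d F ∧ CNF.IsMU1 F := by
  obtain ⟨T, hT, h0⟩ := h
  exact ⟨treeFormula k T, isKSCNF_treeFormula hT fun i hi => Nat.le_zero.1 (h0 i hi),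
    isMU1_treeFormula hk hT⟩

lemma Realizable.mono (h : Realizable k d x) (hxy : ∀ i < k, x i ≤ y i) : Realizable k d y := by
  obtain ⟨T, hT, hx⟩ := h
  exact ⟨T, hT, fun i hi => (hx i hi).trans (hxy i hi)⟩

lemma realizable_of_one_le (h : 1 ≤ x 0) : Realizable k d x :=
  ⟨leaf, trivial, fun i _ => by cases i <;> simp [leafCount, h]⟩

/- If one of the children has no leaf at distance less than `k`, it already realizes `0`. -/
lemma Realizable.node {y : Bool → ℕ → ℕ} (hy : ∀ b, Realizable k d (y b))
    (hyx : ∀ i, i + 1 < k → ∑ b, y b i ≤ x (i + 1))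
    (hd : ∑ b, ∑ i ∈ range k, y b i ≤ d) : Realizable k d x := by
  choose T hT hTy using hy
  by_cases h : ∀ b, ∃ i < k, (T b).leafCount i ≠ 0
  · refine ⟨BTree.node T, ?_, fun i hi => ?_⟩
    · rw [Admissible]
      exact ⟨fun b => ⟨hT b, h b⟩, (sum_le_sum fun b _ => sum_le_sum fun i hi =>
        hTy b i (mem_range.1 hi)).trans hd⟩
    · cases i with
      | zero => exact Nat.zero_le _
      | succ i => exact (sum_le_sum fun b _ => hTy b i (by omega)).trans (hyx i hi)
  · push Not at h
    obtain ⟨b, hb⟩ := h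
    exact ⟨T b, hT b, fun i hi => (hb i hi).le.trans (Nat.zero_le _)⟩

lemma sum_range_delay (x : ℕ → ℕ) (h k : ℕ) :
    ∑ i ∈ range k, (if i < h then 0 else x (i - h)) = ∑ i ∈ range (k - h), x i := by
  rcases le_total h k with hk | hk
  · obtain ⟨m, rfl⟩ := Nat.exists_eq_add_of_le hk
    rw [sum_range_add, sum_eq_zero fun i hi => if_pos (mem_range.1 hi)]
    simp
  · rw [Nat.sub_eq_zero_of_le hk, sum_range_zero]
    exact sum_eq_zero fun i hi => if_pos ((mem_range.1 hi).trans_le hk)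

/- The family is attached to the nodes at depth `h` of a complete binary tree. -/
lemma Realizable.family {N : ℕ} {y : ℕ → ℕ → ℕ} (hy : ∀ p < N, Realizable k d (y p)) (h : ℕ)
    (hsum : ∀ j < h, ∀ s, s + 2 ^ (j + 1) ≤ N →
      ∑ p ∈ range (2 ^ (j + 1)), ∑ i ∈ range (k - j), y (s + p) i ≤ d)
    (s : ℕ) (hs : s + 2 ^ h ≤ N) :
    Realizable k d fun i => if i < h then 0 else ∑ p ∈ range (2 ^ h), y (s + p) (i - h) := by
  induction h generalizing s with
  | zero => simpa using hy s (by simpa using hs)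
  | succ h ih =>
    have hpow : 2 ^ (h + 1) = 2 ^ h + 2 ^ h := by ring
    have hpos : 0 < 2 ^ h := Nat.two_pow_pos h
    have ih' := ih fun j hj => hsum j (by omega)
    refine Realizable.node (y := fun b i => if i < h then 0 else
      ∑ p ∈ range (2 ^ h), y ((bif b then s + 2 ^ h else s) + p) (i - h)) ?_ ?_ ?_
    · rintro (_ | _)
      · exact ih' s (by omega)
      · exact ih' (s + 2 ^ h) (by omega)
    · intro i _
      by_cases hi : i < h
      · simp [hi]
      · simp only [if_neg hi, Nat.add_lt_add_iff_right, Nat.add_sub_add_right, hpow, sum_range_add,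
          Fintype.sum_bool, cond_true, cond_false, add_assoc]
        rw [add_comm]
    · refine le_trans (le_of_eq ?_) (hsum h (by omega) s hs)
      simp only [fun s => sum_range_delay (fun i => ∑ p ∈ range (2 ^ h), y (s + p) i) h k,
        sum_comm (s := range (k - h)), hpow, sum_range_add, Fintype.sum_bool, cond_true,
        cond_false, add_assoc]
      rw [add_comm]

lemma realizable_complete {n : ℕ} (h : 2 ^ n ≤ d) :
    Realizable k d fun i => if i = n then 2 ^ n else 0 := by
  induction n with
  | zero => exact realizable_of_one_le le_rfl
  | succ n ih =>
    have hpow : 2 ^ (n + 1) = 2 ^ n + 2 ^ n := by ring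
    refine Realizable.node (fun _ => ih (by omega)) ?_ ?_
    · intro i _
      by_cases hi : i = n <;> simp [hi, hpow, two_mul]
    · simp only [sum_ite_eq', Fintype.sum_bool]
      split_ifs <;> omega

lemma realizable_zero_two_pow (k : ℕ) : Realizable k (2 ^ k) 0 :=
  (realizable_complete le_rfl).mono fun _ hi => (if_neg hi.ne).le

end Realizable

/-- The vector with `2 ^ (i - μ)` leaves, a fraction `2 ^ (-μ)` of all nodes, on each of the
`2 ^ μ` levels from `s` on. -/
def uniformVec (μ s i : ℕ) : ℕ := if s ≤ i ∧ i < s + 2 ^ μ then 2 ^ (i - μ) else 0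

section Uniform

variable {k d μ s : ℕ}

lemma sum_complete_le (i m : ℕ) :
    ∑ p ∈ range (2 ^ m), ∑ j ∈ range i, (if j = s + p then 2 ^ (s + p) else 0) ≤
      2 ^ (s + 2 ^ m) :=
  calc _ ≤ ∑ p ∈ range (2 ^ m), 2 ^ s * 2 ^ p := by
        refine sum_le_sum fun p _ => ?_
        rw [sum_ite_eq', ← pow_add]
        split_ifs <;> simp
    _ ≤ 2 ^ s * 2 ^ 2 ^ m := by
        rw [← mul_sum]
        exact Nat.mul_le_mul_left _ (Nat.geomSum_lt le_rfl fun p => mem_range.1).le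
    _ = 2 ^ (s + 2 ^ m) := (pow_add 2 _ _).symm

lemma realizable_uniformVec (hs : μ ≤ s) (hd : 2 ^ (s - μ + 2 ^ μ) ≤ d) :
    Realizable k d (uniformVec μ s) := by
  have hle : ∀ p ≤ 2 ^ μ, 2 ^ (s - μ + p) ≤ d := fun p hp =>
    (Nat.pow_le_pow_right two_pos (by omega)).trans hd
  have hfam := Realizable.family (k := k) (N := 2 ^ μ)
    (y := fun p i => if i = s - μ + p then 2 ^ (s - μ + p) else 0)
    (fun p hp => realizable_complete (hle p hp.le)) μ
    (fun j _ s' hs' => ?_) 0 (Nat.zero_add _).le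
  · refine hfam.mono fun i _ => ?_
    rw [uniformVec]
    by_cases hi : s ≤ i ∧ i < s + 2 ^ μ
    · rw [if_neg (by omega), if_pos hi, sum_eq_single_of_mem (i - s) (mem_range.2 (by omega))
        fun p _ hp => if_neg (by omega), if_pos (by omega)]
      exact (congrArg _ (by omega)).le
    · rw [if_neg hi]
      split_ifs with hiμ
      · exact le_rfl
      · refine (sum_eq_zero fun p hp => if_neg ?_).le
        have := mem_range.1 hp
        omega
  · simp only [← add_assoc]
    exact (sum_complete_le (k - j) (j + 1)).trans ((hle _ hs').trans' (by rw [add_assoc]))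

lemma sum_uniformVec_le (hs : μ ≤ s) (n : ℕ) :
    ∑ i ∈ range n, uniformVec μ s i ≤ 2 ^ (s - μ + 2 ^ μ) :=
  calc ∑ i ∈ range n, uniformVec μ s i ≤ ∑ i ∈ Ico s (s + 2 ^ μ), 2 ^ (i - μ) := by
        simp only [uniformVec]
        rw [← sum_filter]
        exact sum_le_sum_of_subset fun i hi => mem_Ico.2 (mem_filter.1 hi).2
    _ = 2 ^ (s - μ) * ∑ j ∈ range (2 ^ μ), 2 ^ j := by
        rw [sum_Ico_eq_sum_range, Nat.add_sub_cancel_left, mul_sum]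
        refine sum_congr rfl fun j _ => ?_
        rw [← pow_add, Nat.sub_add_comm hs]
    _ ≤ 2 ^ (s - μ) * 2 ^ 2 ^ μ :=
        Nat.mul_le_mul_left _ (Nat.geomSum_lt le_rfl fun p => mem_range.1).le
    _ = 2 ^ (s - μ + 2 ^ μ) := (pow_add 2 _ _).symm

end Uniform

lemma sum_range_ite_lt {a n : ℕ} (h : a ≤ n) (u v : ℕ) :
    ∑ p ∈ range n, (if p < a then u else v) = a * u + (n - a) * v := by
  obtain ⟨m, rfl⟩ := Nat.exists_eq_add_of_le h
  rw [sum_range_add, sum_congr rfl fun p hp => if_pos (mem_range.1 hp)]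
  simp

lemma Realizable.mix {k d a h : ℕ} {x y : ℕ → ℕ} (hx : Realizable k d x) (hy : Realizable k d y)
    (ha : a ≤ 2 ^ h)
    (hd : ∀ j < h, 2 ^ (j + 1) * (∑ i ∈ range (k - j), x i + ∑ i ∈ range (k - j), y i) ≤ d) :
    Realizable k d fun i => if i < h then 0 else a * x (i - h) + (2 ^ h - a) * y (i - h) := by
  have hfam := Realizable.family (d := d) (N := 2 ^ h) (y := fun p i => if p < a then x i else y i)
    (fun _ _ => by split_ifs <;> assumption) h (fun j hj s _ => ?_) 0 (Nat.zero_add _).le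
  · simpa only [Nat.zero_add, sum_range_ite_lt ha] using hfam
  · calc _ ≤ ∑ _ ∈ range (2 ^ (j + 1)), ∑ i ∈ range (k - j), (x i + y i) := by
          gcongr
          split_ifs <;> omega
      _ ≤ d := by
          rw [sum_const, card_range, smul_eq_mul, sum_add_distrib]
          exact hd j hj

/-- The levels above depth `k` are divided into blocks of length `L`, counted from `k` upwards.
The profile puts leaves on the blocks `q ≤ Q`: up to rounding, each level of block `q` carries the
fraction `D * φ q / 2 ^ (k + 1)` of all nodes of that level. -/
noncomputable def profile (k L Q : ℕ) (D : ℝ) (φ : ℕ → ℝ) (i : ℕ) : ℕ :=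
  if (k - i) / L ≤ Q then ⌊D * φ ((k - i) / L) / 2 ^ (k - i + 1)⌋₊ else 0

section Profile

variable {k L Q : ℕ} {D r : ℝ} {φ ψ : ℕ → ℝ}

lemma profile_congr (h : ∀ q ≤ Q, φ q = ψ q) : profile k L Q D φ = profile k L Q D ψ := by
  funext i
  unfold profile
  split_ifs with hi
  · rw [h _ hi]
  · rfl

lemma profile_le (hD : 0 ≤ D) (hr : 1 ≤ r) (hφ : ∀ q ≤ Q, φ q ≤ r ^ (L * q)) (i : ℕ) :
    (profile k L Q D φ i : ℝ) ≤ D * (r ^ (k - i) / 2 ^ (k - i + 1)) := by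
  unfold profile
  split_ifs with hi
  · rw [← mul_div_assoc]
    have hle : φ ((k - i) / L) ≤ r ^ (k - i) :=
      (hφ _ hi).trans (pow_le_pow_right₀ hr (Nat.mul_div_le _ _))
    exact (Nat.cast_le.2 (Nat.floor_le_floor (by gcongr))).trans (Nat.floor_le (by positivity))
  · rw [Nat.cast_zero]
    positivity

lemma two_pow_mul_sum_le (hr : 0 ≤ r) (hr2 : r < 2) (h n : ℕ) :
    2 ^ h * ∑ t ∈ Ico h n, r ^ t / 2 ^ (t + 1) ≤ r ^ h / (2 - r) := by
  have hgeom := geom_sum_Ico_le_of_lt_one (m := h) (n := n) (x := r / 2) (by positivity)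
    (by linarith)
  calc 2 ^ h * ∑ t ∈ Ico h n, r ^ t / 2 ^ (t + 1)
      = 2 ^ h / 2 * ∑ t ∈ Ico h n, (r / 2) ^ t := by
        rw [mul_sum, mul_sum]
        refine sum_congr rfl fun t _ => ?_
        rw [div_pow, pow_succ]
        ring
    _ ≤ 2 ^ h / 2 * ((r / 2) ^ h / (1 - r / 2)) := by gcongr
    _ = r ^ h / (2 - r) := by
        have : 2 - r ≠ 0 := by linarith
        rw [div_pow, show 1 - r / 2 = (2 - r) / 2 by ring]
        field_simp

lemma two_pow_mul_sum_profile_le (hD : 0 ≤ D) (hr : 1 ≤ r) (hr2 : r < 2)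
    (hφ : ∀ q ≤ Q, φ q ≤ r ^ (L * q)) {j : ℕ} (hj : j < L) :
    2 ^ (j + 1) * ∑ i ∈ range (k - j), (profile k L Q D φ i : ℝ) ≤ D * (r ^ L / (2 - r)) :=
  calc _ ≤ 2 ^ (j + 1) * ∑ i ∈ range (k - j), D * (r ^ (k - i) / 2 ^ (k - i + 1)) := by
        gcongr with i
        exact profile_le hD hr hφ i
    _ = D * (2 ^ (j + 1) * ∑ t ∈ Ico (k + 1 - (k - j)) (k + 1), r ^ t / 2 ^ (t + 1)) := by
        rw [← mul_sum, mul_left_comm, range_eq_Ico,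
          sum_Ico_reflect (fun t => r ^ t / 2 ^ (t + 1)) 0 (by omega), Nat.sub_zero]
    _ ≤ D * (2 ^ (j + 1) * ∑ t ∈ Ico (j + 1) (k + 1), r ^ t / 2 ^ (t + 1)) := by
        have hsub : Ico (k + 1 - (k - j)) (k + 1) ⊆ Ico (j + 1) (k + 1) := fun t ht => by
          rw [mem_Ico] at ht ⊢
          omega
        gcongr
    _ ≤ D * (r ^ (j + 1) / (2 - r)) := by
        gcongr
        exact two_pow_mul_sum_le (by positivity) hr2 _ _
    _ ≤ D * (r ^ L / (2 - r)) := by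
        have := sub_pos.2 hr2
        gcongr
        exact hj

end Profile

/-- The parameters of the construction: `L = 2 ^ μ` is the length of the blocks of a profile, `Q`
the number of its last block, `D` its density and `r` a bound for the growth of the density from
one level to the next. Between the last block and the root there are at least two full blocks. -/
structure BlockParams (k d μ L Q : ℕ) (D r : ℝ) : Prop where
  length_eq : L = 2 ^ μ
  le_depth : (Q + 3) * L ≤ k
  depth_lt : k < (Q + 4) * L
  density_pos : 0 < D
  one_le_growth : 1 ≤ r
  growth_lt_two : r < 2
  budget : D * (r ^ L / (2 - r)) + 2 ^ (4 * L) ≤ d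

namespace BlockParams

variable {k d μ L Q a n : ℕ} {D r g β : ℝ} {φ φ' : ℕ → ℝ}

lemma log_lt (h : BlockParams k d μ L Q D r) : μ < L := h.length_eq ▸ Nat.lt_two_pow_self

lemma two_pow_le (h : BlockParams k d μ L Q D r) : 2 ^ (4 * L) ≤ d := by
  have hpos := sub_pos.2 h.growth_lt_two
  have hr : 0 ≤ r := zero_le_one.trans h.one_le_growth
  have hD := h.density_pos.le
  have : (2 : ℝ) ^ (4 * L) ≤ d := (le_add_of_nonneg_left (by positivity)).trans h.budget
  exact_mod_cast this

/-- The first level above the last block, so that `uniformVec μ (firstLevel k L Q)` has leaves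
exactly on the levels of block `Q + 1`. -/
def firstLevel (k L Q : ℕ) : ℕ := k - (Q + 2) * L + 1

lemma firstLevel_le (h : BlockParams k d μ L Q D r) : firstLevel k L Q ≤ 2 * L := by
  have := h.log_lt
  have := h.depth_lt
  have : (Q + 4) * L = (Q + 2) * L + 2 * L := by ring
  unfold firstLevel
  omega

lemma log_le_firstLevel (h : BlockParams k d μ L Q D r) : μ ≤ firstLevel k L Q := by
  have := h.le_depth
  have : (Q + 3) * L = (Q + 2) * L + L := by ring
  have := h.log_lt
  unfold firstLevel
  omega

lemma mem_window_iff (h : BlockParams k d μ L Q D r) {i : ℕ} (hi : i ≤ k) :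
    (firstLevel k L Q ≤ i ∧ i < firstLevel k L Q + 2 ^ μ) ↔ (k - i) / L = Q + 1 := by
  have := h.le_depth
  have : (Q + 3) * L = (Q + 2) * L + L := by ring
  have : (Q + 2) * L = (Q + 1) * L + L := by ring
  have := h.log_lt
  rw [Nat.div_eq_iff (by omega), ← h.length_eq, firstLevel]
  omega

lemma realizable_uniformVec (h : BlockParams k d μ L Q D r) :
    Realizable k d (uniformVec μ (firstLevel k L Q)) := by
  refine KSat.realizable_uniformVec h.log_le_firstLevel (le_trans ?_ h.two_pow_le)
  have := h.firstLevel_le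
  exact Nat.pow_le_pow_right two_pos (by rw [← h.length_eq]; omega)

lemma two_pow_mul_sum_uniformVec_le (h : BlockParams k d μ L Q D r) {j : ℕ} (hj : j < L) :
    2 ^ (j + 1) * ∑ i ∈ range (k - j), uniformVec μ (firstLevel k L Q) i ≤ 2 ^ (4 * L) := by
  have := h.firstLevel_le
  calc _ ≤ 2 ^ (j + 1) * 2 ^ (firstLevel k L Q - μ + L) := by
        gcongr
        exact (sum_uniformVec_le h.log_le_firstLevel _).trans_eq (by rw [h.length_eq])
    _ = 2 ^ (j + 1 + (firstLevel k L Q - μ + L)) := (pow_add 2 _ _).symm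
    _ ≤ 2 ^ (4 * L) := Nat.pow_le_pow_right two_pos (by omega)

lemma mul_profile_le (hag : ((2 : ℝ) ^ L - a) * g ≤ 2 ^ L) (ha : a ≤ 2 ^ L) (hD : 0 ≤ D)
    (hg : 0 ≤ g) (hsucc : ∀ q, φ' (q + 1) = g * φ q) (hφ : ∀ q, 0 ≤ φ q) (q t : ℕ) :
    (2 ^ L - a) * ⌊D * φ' (q + 1) / 2 ^ (t + L + 1)⌋₊ ≤ ⌊D * φ q / 2 ^ (t + 1)⌋₊ := by
  refine Nat.le_floor ?_
  have hφq := hφ q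
  have ha' : (0 : ℝ) ≤ 2 ^ L - a := sub_nonneg.2 (by exact_mod_cast ha)
  rw [Nat.cast_mul, Nat.cast_sub ha, Nat.cast_pow, Nat.cast_ofNat, hsucc]
  calc ((2 : ℝ) ^ L - a) * ⌊D * (g * φ q) / 2 ^ (t + L + 1)⌋₊
      ≤ (2 ^ L - a) * (D * (g * φ q) / 2 ^ (t + L + 1)) := by
        gcongr
        exact Nat.floor_le (by positivity)
    _ = ((2 ^ L - a) * g) * (D * φ q / 2 ^ (t + L + 1)) := by ring
    _ ≤ 2 ^ L * (D * φ q / 2 ^ (t + L + 1)) := by gcongr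
    _ = D * φ q / 2 ^ (t + 1) := by
        rw [add_right_comm, pow_add 2 (t + 1) L]
        field_simp

lemma mul_uniform_le (hL : L = 2 ^ μ) (hcond : a * 2 ^ (k + 1) ≤ L * D * 2 ^ L * φ Q)
    {j t : ℕ} (hj : μ ≤ j) (ht : t + L + j = k) :
    a * 2 ^ (j - μ) ≤ ⌊D * φ Q / 2 ^ (t + 1)⌋₊ := by
  refine Nat.le_floor ?_
  have hLR : (L : ℝ) = 2 ^ μ := by rw [hL, Nat.cast_pow, Nat.cast_ofNat]
  have hpow : (2 : ℝ) ^ (j - μ) * 2 ^ (t + 1) * (L * 2 ^ L) = 2 ^ (k + 1) := by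
    rw [hLR, ← pow_add, ← pow_add, ← pow_add]
    exact congrArg _ (by omega)
  have hpos : (0 : ℝ) < L * 2 ^ L := by rw [hLR]; positivity
  rw [le_div_iff₀ (by positivity)]
  push_cast
  refine le_of_mul_le_mul_right ?_ hpos
  calc (a : ℝ) * 2 ^ (j - μ) * 2 ^ (t + 1) * (L * 2 ^ L) = a * 2 ^ (k + 1) := by
        rw [← hpow]; ring
    _ ≤ L * D * 2 ^ L * φ Q := hcond
    _ = D * φ Q * (L * 2 ^ L) := by ring

lemma mix_le_profile (h : BlockParams k d μ L Q D r) (hg : 0 ≤ g) (ha : a ≤ 2 ^ L)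
    (hag : ((2 : ℝ) ^ L - a) * g ≤ 2 ^ L) (hφ : ∀ q, 0 ≤ φ q)
    (hsucc : ∀ q, φ' (q + 1) = g * φ q) (hcond : a * 2 ^ (k + 1) ≤ L * D * 2 ^ L * φ Q)
    {j : ℕ} (hj : L + j ≤ k) :
    a * uniformVec μ (firstLevel k L Q) j + (2 ^ L - a) * profile k L Q D φ' j ≤
      profile k L Q D φ (L + j) := by
  obtain ⟨t, rfl⟩ := Nat.exists_eq_add_of_le' hj
  have hdiv : (t + (L + j) - j) / L = t / L + 1 := by
    rw [← add_assoc, Nat.add_sub_cancel,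
      Nat.add_div_right t ((Nat.zero_le μ).trans_lt h.log_lt)]
  have hwin := h.mem_window_iff (i := j) (by omega)
  rw [hdiv] at hwin
  simp only [profile, uniformVec, if_congr hwin rfl rfl, hdiv, Nat.add_sub_cancel]
  rw [show t + (L + j) - j = t + L by omega]
  rcases lt_trichotomy (t / L) Q with hlt | heq | hgt
  · rw [if_neg (by omega), if_pos (by omega), if_pos (by omega), mul_zero, zero_add]
    exact mul_profile_le hag ha h.density_pos.le hg hsucc hφ _ t
  · rw [if_pos (by omega), if_neg (by omega), if_pos heq.le, mul_zero, add_zero, heq]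
    exact mul_uniform_le h.length_eq hcond
      (h.log_le_firstLevel.trans (hwin.2 (by omega)).1) (by omega)
  · rw [if_neg (by omega), if_neg (by omega), if_neg (by omega), mul_zero, mul_zero, add_zero]

/- Of the `2 ^ L` nodes at distance `L` below the root, `a` get the uniform tree that supplies the
leaves of block `Q`, and the others get the profile `φ'`. -/
lemma realizable_profile (h : BlockParams k d μ L Q D r) (hg : 0 ≤ g) (ha : a ≤ 2 ^ L)
    (hag : ((2 : ℝ) ^ L - a) * g ≤ 2 ^ L) (hφ : ∀ q, 0 ≤ φ q)
    (hsucc : ∀ q, φ' (q + 1) = g * φ q) (hφ' : ∀ q ≤ Q, φ' q ≤ r ^ (L * q))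
    (hcond : a * 2 ^ (k + 1) ≤ L * D * 2 ^ L * φ Q)
    (hreal : Realizable k d (profile k L Q D φ')) : Realizable k d (profile k L Q D φ) := by
  refine (h.realizable_uniformVec.mix hreal ha fun j hj => ?_).mono fun i hi => ?_
  · have huniform : (2 : ℝ) ^ (j + 1) *
        ∑ i ∈ range (k - j), (uniformVec μ (firstLevel k L Q) i : ℝ) ≤ 2 ^ (4 * L) := by
      exact_mod_cast h.two_pow_mul_sum_uniformVec_le hj
    have hprofile := two_pow_mul_sum_profile_le (k := k) h.density_pos.le h.one_le_growth
      h.growth_lt_two hφ' hj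
    have : (2 : ℝ) ^ (j + 1) * (∑ i ∈ range (k - j), (uniformVec μ (firstLevel k L Q) i : ℝ) +
        ∑ i ∈ range (k - j), (profile k L Q D φ' i : ℝ)) ≤ d := by
      rw [mul_add]
      linarith [h.budget]
    exact_mod_cast this
  · split_ifs with hiL
    · exact Nat.zero_le _
    · obtain ⟨j, rfl⟩ := Nat.exists_eq_add_of_le (not_lt.1 hiL)
      rw [Nat.add_sub_cancel_left]
      exact h.mix_le_profile hg ha hag hφ hsucc hcond hi.le

/-- The density that grows by the factor `g` from each of the first `j` blocks to the next, and by
the factor `β` afterwards. -/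
noncomputable def mixedGrowth (g β : ℝ) (j q : ℕ) : ℝ :=
  if q < j then g ^ q else g ^ j * β ^ (q - j)

lemma mixedGrowth_succ (g β : ℝ) (j q : ℕ) :
    mixedGrowth g β (j + 1) (q + 1) = g * mixedGrowth g β j q := by
  simp only [mixedGrowth, Nat.add_lt_add_iff_right, Nat.add_sub_add_right]
  split_ifs <;> ring

lemma mixedGrowth_nonneg (hg : 0 ≤ g) (hβ : 0 ≤ β) (j q : ℕ) : 0 ≤ mixedGrowth g β j q := by
  unfold mixedGrowth
  split_ifs <;> positivity

lemma mixedGrowth_le (hβ : 0 ≤ β) (hβg : β ≤ g) (j q : ℕ) : mixedGrowth g β j q ≤ g ^ q := by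
  have := hβ.trans hβg
  unfold mixedGrowth
  split_ifs with hq
  · exact le_rfl
  · calc g ^ j * β ^ (q - j) ≤ g ^ j * g ^ (q - j) := by gcongr
      _ = g ^ q := by rw [← pow_add, Nat.add_sub_cancel' (not_lt.1 hq)]

lemma pow_le_mixedGrowth (hβ : 0 ≤ β) (hβg : β ≤ g) (j q : ℕ) : β ^ q ≤ mixedGrowth g β j q := by
  have := hβ.trans hβg
  unfold mixedGrowth
  split_ifs with hq
  · gcongr
  · calc β ^ q = β ^ j * β ^ (q - j) := by rw [← pow_add, Nat.add_sub_cancel' (not_lt.1 hq)]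
      _ ≤ g ^ j * β ^ (q - j) := by gcongr

/- The growth is changed from `g` to `β` one block at a time, beginning with the last one. -/
lemma realizable_profile_pow (h : BlockParams k d μ L Q D r) (hβ : 0 ≤ β) (hβg : β ≤ g)
    (hgr : g ≤ r ^ L) (ha : a ≤ 2 ^ L) (hag : ((2 : ℝ) ^ L - a) * g ≤ 2 ^ L)
    (hcond : a * 2 ^ (k + 1) ≤ L * D * 2 ^ L * β ^ Q)
    (hreal : Realizable k d (profile k L Q D (g ^ ·))) :
    Realizable k d (profile k L Q D (β ^ ·)) := by
  have hg : 0 ≤ g := hβ.trans hβg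
  have hmixed : ∀ j ≤ Q + 1, Realizable k d (profile k L Q D (mixedGrowth g β j)) := by
    intro j hj
    induction hj using Nat.decreasingInduction with
    | self =>
      have hpow : ∀ q ≤ Q, mixedGrowth g β (Q + 1) q = g ^ q := fun q hq =>
        if_pos (Nat.lt_succ_of_le hq)
      rwa [profile_congr hpow]
    | of_succ j _ ih =>
      refine h.realizable_profile hg ha hag (mixedGrowth_nonneg hg hβ j) (mixedGrowth_succ g β j)
        (fun q _ => ?_) (hcond.trans ?_) ih
      · rw [pow_mul]
        exact (mixedGrowth_le hβ hβg _ q).trans (pow_le_pow_left₀ hg hgr q)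
      · have := h.density_pos.le
        gcongr
        exact pow_le_mixedGrowth hβ hβg j Q
  convert hmixed 0 (Nat.zero_le _) using 2
  funext q
  simp [mixedGrowth]

lemma realizable_profile_one (h : BlockParams k d μ L Q D r) (hn : n ≤ 2 ^ L)
    (hr : 1 + n / 2 ^ L ≤ r ^ L)
    (hcond : ∀ a < n, ((a : ℝ) + 1) * 2 ^ (k + 1) ≤ L * D * 2 ^ L * (1 + a / 2 ^ L) ^ Q)
    (hreal : Realizable k d (profile k L Q D ((1 + n / 2 ^ L : ℝ) ^ ·))) :
    Realizable k d (profile k L Q D fun _ => 1) := by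
  have hgrowth : ∀ a ≤ n, Realizable k d (profile k L Q D ((1 + a / 2 ^ L : ℝ) ^ ·)) := by
    intro a ha
    induction ha using Nat.decreasingInduction with
    | self => exact hreal
    | of_succ a ha ih =>
      have hmono : (1 : ℝ) + (a + 1 : ℕ) / 2 ^ L ≤ 1 + n / 2 ^ L := by
        gcongr
        exact ha
      have hag : ((2 : ℝ) ^ L - (a + 1 : ℕ)) * (1 + (a + 1 : ℕ) / 2 ^ L) ≤ 2 ^ L :=
        calc _ = (2 : ℝ) ^ L - ((a + 1 : ℕ) : ℝ) ^ 2 / 2 ^ L := by field_simp; ring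
          _ ≤ 2 ^ L := sub_le_self _ (by positivity)
      refine h.realizable_profile_pow (a := a + 1) (by positivity) ?_ (hmono.trans hr)
        (le_trans ha hn) hag (by exact_mod_cast hcond a ha) ih
      gcongr
      exact Nat.le_succ a
  simpa using hgrowth 0 n.zero_le

/- The density is first made constant, then the leaves are confined to block `0`, and finally they
disappear. -/
lemma realizable_zero (h : BlockParams k d μ L Q D r) (hn : n ≤ 2 ^ L)
    (hr : 1 + n / 2 ^ L ≤ r ^ L)
    (hcond : ∀ a < n, ((a : ℝ) + 1) * 2 ^ (k + 1) ≤ L * D * 2 ^ L * (1 + a / 2 ^ L) ^ Q)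
    (hreal : Realizable k d (profile k L Q D ((1 + n / 2 ^ L : ℝ) ^ ·))) : Realizable k d 0 := by
  have hD := h.density_pos
  have hrL : 1 ≤ r ^ L := one_le_pow₀ h.one_le_growth
  have hblock : Realizable k d (profile k L Q D ((0 : ℝ) ^ ·)) :=
    h.realizable_profile_pow (g := 1) (a := 0) le_rfl zero_le_one hrL (Nat.zero_le _) (by simp)
      (by rw [Nat.cast_zero, zero_mul]; positivity)
      (by simpa only [one_pow] using h.realizable_profile_one hn hr hcond hreal)
  have hzero : Realizable k d (profile k L Q D 0) :=
    h.realizable_profile (φ' := ((0 : ℝ) ^ ·)) (g := 1) (a := 0) zero_le_one (Nat.zero_le _)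
      (by simp) (fun _ => le_rfl) (fun q => by simp) (fun q _ => ?_) (by simp) hblock
  · convert hzero using 1
    funext i
    simp [profile]
  · exact pow_mul r L q ▸ pow_le_pow_left₀ le_rfl (zero_le_one.trans hrL) q

end BlockParams

lemma exp_one_mul_le_one_add_pow {x : ℝ} (hx : 0 ≤ x) (n : ℕ) :
    Real.exp 1 * ((n - 1) * x) ≤ (1 + x) ^ n := by
  cases n with
  | zero =>
    rw [Nat.cast_zero, zero_sub, pow_zero]
    linarith [mul_nonneg (Real.exp_pos 1).le hx]
  | succ n =>
    have hpos : 0 < 1 + x := by positivity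
    calc Real.exp 1 * (((n + 1 : ℕ) - 1) * x)
        = Real.exp 1 * (n * (1 - (1 + x)⁻¹)) * (1 + x) := by
          push_cast
          field_simp
          ring
      _ ≤ Real.exp 1 * (n * Real.log (1 + x)) * (1 + x) := by
          gcongr
          exact Real.one_sub_inv_le_log_of_pos hpos
      _ ≤ Real.exp (n * Real.log (1 + x)) * (1 + x) := by
          gcongr
          exact Real.exp_one_mul_le_exp
      _ = (1 + x) ^ (n + 1) := by rw [Real.exp_nat_mul, Real.exp_log hpos, pow_succ]

lemma eight_mul_sq_le_two_pow {n : ℕ} (h : 10 ≤ n) : 8 * n ^ 2 ≤ 2 ^ n := by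
  induction n, h using Nat.le_induction with
  | base => norm_num
  | succ m hm ih => rw [pow_succ 2 m]; nlinarith

/-- The length `L = 2 ^ μ` of the blocks is chosen of order `√k`. -/
structure BlockLength (k μ L : ℕ) : Prop where
  seven_le : 7 ≤ μ
  length_eq : L = 2 ^ μ
  sq_le : L * L ≤ k
  lt_four_mul_sq : k < 4 * (L * L)

/-- The density of the profiles. Its factor `1 + 21 / L` compensates for rounding `k / L` to the
number of blocks and `a` to an integer in `BlockLength.succ_mul_two_pow_le`. -/
noncomputable def density (k L : ℕ) : ℝ := 2 ^ (k + 1) / (Real.exp 1 * k) * (1 + 21 / L)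

/-- The bound for the growth of the density from one level to the next. -/
noncomputable def levelGrowth (L : ℕ) : ℝ := 1 + 128 / (L * L)

namespace BlockLength

variable {k d μ L : ℕ}

lemma le_length (h : BlockLength k μ L) : 128 ≤ L :=
  h.length_eq ▸ Nat.pow_le_pow_right two_pos h.seven_le

lemma le_length_real (h : BlockLength k μ L) : (128 : ℝ) ≤ L := by exact_mod_cast h.le_length

lemma depth_pos (h : BlockLength k μ L) : (0 : ℝ) < k := by
  have := h.le_length
  have := h.sq_le
  exact_mod_cast (show 0 < k by nlinarith)

lemma length_eq_real (h : BlockLength k μ L) : (L : ℝ) = 2 ^ μ := by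
  exact_mod_cast h.length_eq

lemma log_lt (h : BlockLength k μ L) : μ < L := h.length_eq ▸ Nat.lt_two_pow_self

lemma density_mul (h : BlockLength k μ L) :
    density k L * (Real.exp 1 * k) * L = 2 ^ (k + 1) * (L + 21) := by
  have := h.depth_pos
  have := h.le_length_real
  unfold density
  field_simp

lemma density_pos (h : BlockLength k μ L) : 0 < density k L := by
  have := h.depth_pos
  unfold density
  positivity

lemma two_pow_le_density_mul (h : BlockLength k μ L) :
    2 ^ (k + 1) ≤ density k L * (11 * (L * L)) := by
  have hk : (k : ℝ) ≤ 4 * (L * L) := by exact_mod_cast h.lt_four_mul_sq.le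
  have hL := h.le_length_real
  have hD := h.density_pos
  have hDk : 2 ^ (k + 1) ≤ density k L * (Real.exp 1 * k) := by
    refine le_of_mul_le_mul_right ?_ (show (0 : ℝ) < L by positivity)
    rw [h.density_mul]
    gcongr
    linarith
  have hek : Real.exp 1 * k ≤ 11 * (L * L) := by
    have := Real.exp_one_lt_d9
    nlinarith
  exact hDk.trans (by gcongr)

lemma levelGrowth_pow_le (h : BlockLength k μ L) : levelGrowth L ^ L ≤ 1 + 256 / L := by
  have hL := h.le_length_real
  have hx : |(128 : ℝ) / L| ≤ 1 := by
    rw [abs_of_nonneg (by positivity)]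
    exact div_le_one_of_le₀ hL (by positivity)
  have hsq : ((128 : ℝ) / L) ^ 2 ≤ 128 / L := by
    rw [abs_of_nonneg (by positivity)] at hx
    exact pow_le_of_le_one (by positivity) hx two_ne_zero
  calc levelGrowth L ^ L ≤ Real.exp (128 / (L * L)) ^ L := by
        unfold levelGrowth
        gcongr
        rw [add_comm]
        exact Real.add_one_le_exp _
    _ = Real.exp (128 / L) := by
        rw [← Real.exp_nat_mul]
        congr 1
        field_simp
    _ ≤ 1 + 128 / L + (128 / L) ^ 2 := by
        linarith [le_of_abs_le (Real.abs_exp_sub_one_sub_id_le hx)]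
    _ ≤ 1 + 256 / L := by
        linarith [show (256 : ℝ) / L = 128 / L + 128 / L by ring]

lemma levelGrowth_le (h : BlockLength k μ L) : levelGrowth L ≤ 1 + 1 / L := by
  have hL := h.le_length_real
  unfold levelGrowth
  gcongr 1 + ?_
  rw [div_le_div_iff₀ (by positivity) (by positivity)]
  nlinarith

lemma levelGrowth_lt_two (h : BlockLength k μ L) : levelGrowth L < 2 := by
  have hL := h.le_length_real
  have : 1 / (L : ℝ) < 1 := by
    rw [div_lt_one (by positivity)]
    linarith
  linarith [h.levelGrowth_le]

lemma levelGrowth_pow_div_le (h : BlockLength k μ L) :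
    levelGrowth L ^ L / (2 - levelGrowth L) ≤ 1 + 262 / L := by
  have hL := h.le_length_real
  have hL' : (L : ℝ) ≠ 0 := by positivity
  rw [div_le_iff₀ (sub_pos.2 h.levelGrowth_lt_two)]
  calc levelGrowth L ^ L ≤ 1 + 256 / L := h.levelGrowth_pow_le
    _ ≤ (1 + 262 / L) * (1 - 1 / L) := by
        field_simp
        nlinarith
    _ ≤ (1 + 262 / L) * (2 - levelGrowth L) := by
        exact mul_le_mul_of_nonneg_left (by linarith [h.levelGrowth_le]) (by positivity)

lemma length_le (h : BlockLength k μ L) : L ≤ k / L :=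
  (Nat.le_div_iff_mul_le (by linarith [h.le_length])).2 h.sq_le

lemma blockParams (h : BlockLength k μ L)
    (hd : density k L * (1 + 262 / L) + 2 ^ (4 * L) ≤ d) :
    BlockParams k d μ L (k / L - 3) (density k L) (levelGrowth L) where
  length_eq := h.length_eq
  le_depth := by
    rw [Nat.sub_add_cancel (by linarith [h.le_length, h.length_le])]
    exact Nat.div_mul_le_self k L
  depth_lt := by
    have hL := h.le_length
    have := h.length_le
    rw [show k / L - 3 + 4 = k / L + 1 by omega, mul_comm]
    exact Nat.lt_mul_div_succ k (by omega)
  density_pos := h.density_pos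
  one_le_growth := le_add_of_nonneg_right (by positivity)
  growth_lt_two := h.levelGrowth_lt_two
  budget := by
    have := h.density_pos
    refine le_trans ?_ hd
    gcongr
    exact h.levelGrowth_pow_div_le

lemma exp_one_mul_depth_le (h : BlockLength k μ L) : Real.exp 1 * k ≤ 11 * 2 ^ L := by
  have hk : (k : ℝ) ≤ 4 * (L * L) := by exact_mod_cast h.lt_four_mul_sq.le
  have hL : (8 : ℝ) * L ^ 2 ≤ 2 ^ L := by
    exact_mod_cast eight_mul_sq_le_two_pow (le_trans (by norm_num) h.le_length)
  have := Real.exp_one_lt_d9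
  nlinarith

lemma depth_le (h : BlockLength k μ L) : (k : ℝ) ≤ (L + 10) * ((k / L - 3 : ℕ) - 1) := by
  have hL := h.le_length
  have hk : k < L * (k / L + 1) := Nat.lt_mul_div_succ k (by omega)
  obtain ⟨Q, hQ⟩ : ∃ Q, k / L = Q + 3 := Nat.exists_eq_add_of_le' (le_trans (by omega) h.length_le)
  have hLQ : (L : ℝ) ≤ Q + 3 := by exact_mod_cast hQ ▸ h.length_le
  rw [hQ] at hk ⊢
  have hk' : (k : ℝ) ≤ L * (Q + 4) := by exact_mod_cast hk.le
  have := h.le_length_real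
  rw [Nat.add_sub_cancel]
  nlinarith

lemma succ_mul_two_pow_le (h : BlockLength k μ L) (a : ℕ) :
    ((a : ℝ) + 1) * 2 ^ (k + 1) ≤
      L * density k L * 2 ^ L * (1 + a / 2 ^ L) ^ (k / L - 3) := by
  set x : ℝ := a / 2 ^ L with hx
  set Q := k / L - 3
  have hx0 : 0 ≤ x := by positivity
  have hek : 0 < Real.exp 1 * k := mul_pos (Real.exp_pos 1) h.depth_pos
  have hrounding : Real.exp 1 * k ≤ 11 * 2 ^ L * (1 + x) ^ Q :=
    h.exp_one_mul_depth_le.trans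
      (le_mul_of_one_le_right (by positivity) (one_le_pow₀ (by linarith)))
  have hmain : a * (Real.exp 1 * k) ≤ (L + 10) * 2 ^ L * (1 + x) ^ Q :=
    calc a * (Real.exp 1 * k) ≤ a * (Real.exp 1 * ((L + 10) * (Q - 1))) := by
          gcongr
          exact h.depth_le
      _ = (L + 10) * 2 ^ L * (Real.exp 1 * ((Q - 1) * x)) := by
          rw [hx]
          field_simp
      _ ≤ (L + 10) * 2 ^ L * (1 + x) ^ Q := by
          gcongr
          exact exp_one_mul_le_one_add_pow hx0 Q
  refine le_of_mul_le_mul_right ?_ hek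
  calc (a + 1) * 2 ^ (k + 1) * (Real.exp 1 * k)
      = 2 ^ (k + 1) * (a * (Real.exp 1 * k) + Real.exp 1 * k) := by ring
    _ ≤ 2 ^ (k + 1) * ((L + 21) * 2 ^ L * (1 + x) ^ Q) := by
        gcongr
        linarith
    _ = (density k L * (Real.exp 1 * k) * L) * (2 ^ L * (1 + x) ^ Q) := by
        rw [h.density_mul]
        ring
    _ = L * density k L * 2 ^ L * (1 + x) ^ Q * (Real.exp 1 * k) := by ring

lemma two_pow_mul_four (h : BlockLength k μ L) : 2 ^ (2 * μ - 2) * 4 = L * L := by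
  have := h.seven_le
  rw [h.length_eq, ← pow_add, show 4 = 2 ^ 2 from rfl, ← pow_add]
  congr 1
  omega

lemma realizable_uniformVec (h : BlockLength k μ L) (hd : density k L ≤ d) :
    Realizable k d (uniformVec (2 * μ - 2) (3 * L)) := by
  have hμ := h.seven_le
  have hμL := h.log_lt
  refine KSat.realizable_uniformVec (by omega) ?_
  have hexp : 3 * L - (2 * μ - 2) + 2 ^ (2 * μ - 2) + (4 + 2 * μ) ≤ k + 1 := by
    have := h.two_pow_mul_four
    have := Nat.mul_le_mul_right L h.le_length
    have := h.sq_le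
    omega
  have hLL : (2 : ℝ) ^ (2 * μ) = L * L := by rw [h.length_eq_real, two_mul, pow_add]
  have hL := h.le_length_real
  have : (2 : ℝ) ^ (3 * L - (2 * μ - 2) + 2 ^ (2 * μ - 2)) ≤ density k L := by
    refine le_of_mul_le_mul_right ?_ (show (0 : ℝ) < 2 ^ 4 * 2 ^ (2 * μ) by positivity)
    calc _ = (2 : ℝ) ^ (3 * L - (2 * μ - 2) + 2 ^ (2 * μ - 2) + (4 + 2 * μ)) := by
          rw [← pow_add, ← pow_add]
      _ ≤ 2 ^ (k + 1) := pow_le_pow_right₀ one_le_two hexp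
      _ ≤ density k L * (11 * (L * L)) := h.two_pow_le_density_mul
      _ ≤ density k L * (2 ^ 4 * 2 ^ (2 * μ)) := by
          have := h.density_pos
          rw [hLL]
          gcongr
          norm_num
  exact_mod_cast this.trans hd

lemma le_growth_pow (h : BlockLength k μ L) {q : ℕ} (hq : L ≤ 2 * (q + 1)) :
    44 ≤ (1 + 128 / L : ℝ) ^ q := by
  have hL := h.le_length_real
  have hq' : (L : ℝ) ≤ 2 * (q + 1) := by exact_mod_cast hq
  have : 43 ≤ (q : ℝ) * (128 / L) := by
    rw [mul_div_assoc', le_div_iff₀ (by positivity)]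
    linarith
  calc (44 : ℝ) ≤ 1 + q * (128 / L) := by linarith
    _ ≤ (1 + 128 / L) ^ q :=
        one_add_mul_le_pow (le_trans (by norm_num) (show (0 : ℝ) ≤ 128 / L by positivity)) q

lemma block_mem_of_window (h : BlockLength k μ L) {i : ℕ} (hi : i ≤ k) (hl : 3 * L ≤ i)
    (hr : i < 3 * L + 2 ^ (2 * μ - 2)) :
    (k - i) / L ≤ k / L - 3 ∧ L ≤ 2 * ((k - i) / L + 1) := by
  have hL := h.le_length
  constructor
  · rw [← Nat.sub_mul_div, mul_comm L 3]
    exact Nat.div_le_div_right (by omega)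
  · have hlt : k - i < L * ((k - i) / L + 1) := Nat.lt_mul_div_succ _ (by omega)
    have hhalf : L * L ≤ 2 * (k - i) := by
      have := h.two_pow_mul_four
      have := Nat.mul_le_mul_right L hL
      have := h.sq_le
      omega
    nlinarith

lemma uniformVec_le_profile (h : BlockLength k μ L) {i : ℕ} (hi : i ≤ k) :
    uniformVec (2 * μ - 2) (3 * L) i ≤
      profile k L (k / L - 3) (density k L) ((1 + 128 / L : ℝ) ^ ·) i := by
  unfold uniformVec
  split_ifs with hwindow
  swap
  · exact Nat.zero_le _
  obtain ⟨hblock, hq⟩ := h.block_mem_of_window hi hwindow.1 hwindow.2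
  have hD := h.density_pos
  rw [profile, if_pos hblock]
  refine Nat.le_floor ?_
  rw [le_div_iff₀ (by positivity)]
  refine le_of_mul_le_mul_right ?_ (show (0 : ℝ) < 2 ^ (2 * μ - 2) by positivity)
  push_cast
  calc (2 : ℝ) ^ (i - (2 * μ - 2)) * 2 ^ (k - i + 1) * 2 ^ (2 * μ - 2) = 2 ^ (k + 1) := by
        have := h.log_lt
        rw [← pow_add, ← pow_add]
        congr 1
        omega
    _ ≤ density k L * (11 * (L * L)) := h.two_pow_le_density_mul
    _ = density k L * 44 * 2 ^ (2 * μ - 2) := by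
        have : (2 : ℝ) ^ (2 * μ - 2) * 4 = L * L := by exact_mod_cast h.two_pow_mul_four
        rw [← this]
        ring
    _ ≤ density k L * (1 + 128 / L) ^ ((k - i) / L) * 2 ^ (2 * μ - 2) := by
        gcongr
        exact h.le_growth_pow hq

lemma realizable_zero (h : BlockLength k μ L)
    (hd : density k L * (1 + 262 / L) + 2 ^ (4 * L) ≤ d) : Realizable k d 0 := by
  have := h.density_pos
  have hdd : density k L ≤ d := by
    refine le_trans ?_ hd
    have : 0 ≤ density k L * (262 / L) + 2 ^ (4 * L) := by positivity
    linarith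
  have hn : 1 + ((2 ^ (L - μ + 7) : ℕ) : ℝ) / 2 ^ L = 1 + 128 / L := by
    have hexp : 2 ^ (L - μ + 7) * 2 ^ μ = (128 : ℝ) * 2 ^ L := by
      have := h.log_lt
      rw [show (128 : ℝ) = 2 ^ 7 by norm_num, ← pow_add, ← pow_add]
      congr 1
      omega
    rw [add_right_inj, div_eq_div_iff (by positivity) (by have := h.le_length_real; positivity),
      ← hexp, h.length_eq_real, Nat.cast_pow, Nat.cast_ofNat]
  have hpow : 1 + 128 / (L : ℝ) ≤ levelGrowth L ^ L := by
    have hnonneg : (0 : ℝ) ≤ 128 / (L * L) := by positivity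
    have hL := h.le_length_real
    calc 1 + 128 / (L : ℝ) = 1 + L * (128 / (L * L)) := by field_simp
      _ ≤ levelGrowth L ^ L := one_add_mul_le_pow (by linarith) L
  refine (h.blockParams hd).realizable_zero (n := 2 ^ (L - μ + 7))
    (Nat.pow_le_pow_right two_pos (by have := h.seven_le; have := h.log_lt; omega)) (by rwa [hn])
    (fun a _ => h.succ_mul_two_pow_le a) ?_
  rw [hn]
  exact (h.realizable_uniformVec hdd).mono fun i hi => h.uniformVec_le_profile hi.le

lemma two_pow_mul_length_le (h : BlockLength k μ L) :
    2 ^ (4 * L) ≤ (2 : ℝ) ^ (k + 1) / k / L := by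
  have hk := h.depth_pos
  have hL := h.le_length_real
  have hkL : (k : ℝ) * L ≤ 2 ^ (3 * μ + 2) := by
    have hk4 : (k : ℝ) ≤ 4 * (L * L) := by exact_mod_cast h.lt_four_mul_sq.le
    calc (k : ℝ) * L ≤ 4 * (L * L) * L := by gcongr
      _ = 2 ^ (3 * μ + 2) := by
          rw [h.length_eq_real]
          ring
  have hexp : 4 * L + (3 * μ + 2) ≤ k + 1 := by
    have := h.log_lt
    have := Nat.mul_le_mul_right L h.le_length
    have := h.sq_le
    omega
  rw [div_div, le_div_iff₀ (by positivity)]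
  calc (2 : ℝ) ^ (4 * L) * (k * L) ≤ 2 ^ (4 * L) * 2 ^ (3 * μ + 2) := by gcongr
    _ = 2 ^ (4 * L + (3 * μ + 2)) := (pow_add _ _ _).symm
    _ ≤ 2 ^ (k + 1) := pow_le_pow_right₀ one_le_two hexp

lemma density_mul_le (h : BlockLength k μ L) :
    density k L * (1 + 262 / L) ≤ ((Real.exp 1)⁻¹ + 5785 / L) * (2 ^ (k + 1) / k) := by
  have hk := h.depth_pos
  have hL := h.le_length_real
  have he : (Real.exp 1)⁻¹ ≤ 1 := inv_le_one_of_one_le₀ (Real.one_le_exp zero_le_one)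
  have hfactor : (1 + 21 / L) * (1 + 262 / L) ≤ 1 + 5785 / (L : ℝ) := by
    field_simp
    nlinarith
  calc density k L * (1 + 262 / L)
      = (Real.exp 1)⁻¹ * ((1 + 21 / L) * (1 + 262 / L)) * (2 ^ (k + 1) / k) := by
        unfold density
        field_simp
    _ ≤ (Real.exp 1)⁻¹ * (1 + 5785 / L) * (2 ^ (k + 1) / k) := by gcongr
    _ ≤ ((Real.exp 1)⁻¹ + 5785 / L) * (2 ^ (k + 1) / k) := by
        gcongr
        rw [mul_add, mul_one]
        gcongr
        exact mul_le_of_le_one_left (by positivity) he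

lemma exists_realizable_zero (h : BlockLength k μ L) :
    ∃ d : ℕ, Realizable k d 0 ∧
      (d : ℝ) ≤ ((Real.exp 1)⁻¹ + 5787 / L) * (2 ^ (k + 1) / k) := by
  have hD := h.density_pos
  refine ⟨_, h.realizable_zero (Nat.le_ceil _), (Nat.ceil_lt_add_one (by positivity)).le.trans ?_⟩
  have hone : (1 : ℝ) ≤ 2 ^ (4 * L) := one_le_pow₀ one_le_two
  have hsplit : ((Real.exp 1)⁻¹ + 5787 / L) * (2 ^ (k + 1) / k) =
      ((Real.exp 1)⁻¹ + 5785 / L) * (2 ^ (k + 1) / k) + 2 * (2 ^ (k + 1) / k / L) := by ring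
  linarith [h.density_mul_le, h.two_pow_mul_length_le]

lemma two_pow_log (hk : 4 ^ 7 ≤ k) : BlockLength k (Nat.log 4 k) (2 ^ Nat.log 4 k) where
  seven_le := Nat.le_log_of_pow_le (by norm_num) hk
  length_eq := rfl
  sq_le := by
    rw [← mul_pow]
    exact Nat.pow_log_le_self 4 (by omega)
  lt_four_mul_sq := by
    rw [← mul_pow]
    exact (Nat.lt_pow_succ_log_self (by norm_num) k).trans_eq (pow_succ' 4 _)

lemma one_div_length_le (h : BlockLength k μ L) : 1 / (L : ℝ) ≤ 2 * (√k)⁻¹ := by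
  have hL := h.le_length_real
  have hk := h.depth_pos
  have hsqrt : √(k : ℝ) ≤ 2 * L := by
    rw [Real.sqrt_le_left (by positivity), mul_pow, sq (L : ℝ)]
    exact_mod_cast h.lt_four_mul_sq.le
  rw [← div_eq_mul_inv, div_le_div_iff₀ (by positivity) (by positivity), one_mul]
  exact hsqrt

end BlockLength

lemma two_pow_le_of_lt {k : ℕ} (hk : 1 ≤ k) (hk' : k < 4 ^ 7) :
    (2 : ℝ) ^ k ≤ 4 ^ 14 * (√k)⁻¹ * (2 ^ (k + 1) / k) := by
  have : (0 : ℝ) < k := by exact_mod_cast hk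
  have hle : (k : ℝ) ≤ 4 ^ 7 := by exact_mod_cast hk'.le
  have hsqrt : √(k : ℝ) ≤ 4 ^ 7 := by
    rw [Real.sqrt_le_left (by positivity)]
    exact hle.trans (by norm_num)
  rw [← div_eq_mul_inv, div_mul_div_comm, le_div_iff₀ (by positivity)]
  calc (2 : ℝ) ^ k * (√k * k) ≤ 2 ^ (k + 1) * (4 ^ 7 * 4 ^ 7) := by
        gcongr
        · exact one_le_two
        · exact Nat.le_succ k
    _ = 4 ^ 14 * 2 ^ (k + 1) := by ring

lemma exists_mu1_formula : ∃ C : ℝ, 0 ≤ C ∧ ∀ k : ℕ, 1 ≤ k →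
    ∃ (s : ℕ) (F : CNF), CNF.IsKSCNF k s F ∧ CNF.IsMU1 F ∧
      (s : ℝ) ≤ ((Real.exp 1)⁻¹ + C * (k : ℝ) ^ (-(1 / 2 : ℝ))) * ((2 : ℝ) ^ (k + 1) / k) := by
  refine ⟨4 ^ 14, by positivity, fun k hk => ?_⟩
  suffices ∃ s : ℕ, Realizable k s 0 ∧
      (s : ℝ) ≤ ((Real.exp 1)⁻¹ + 4 ^ 14 * (√k)⁻¹) * (2 ^ (k + 1) / k) by
    obtain ⟨s, hs, hle⟩ := this
    obtain ⟨F, hF, hMU⟩ := exists_formula_of_realizable_zero hk hs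
    refine ⟨s, F, hF, hMU, ?_⟩
    rwa [Real.rpow_neg k.cast_nonneg, ← Real.sqrt_eq_rpow]
  rcases lt_or_ge k (4 ^ 7) with hsmall | hlarge
  · refine ⟨2 ^ k, realizable_zero_two_pow k, ?_⟩
    have hlead : 0 ≤ (Real.exp 1)⁻¹ * (2 ^ (k + 1) / k) := by positivity
    push_cast
    linarith [two_pow_le_of_lt hk hsmall]
  · obtain ⟨s, hs, hle⟩ := (BlockLength.two_pow_log hlarge).exists_realizable_zero
    refine ⟨s, hs, hle.trans ?_⟩
    have hlength := (BlockLength.two_pow_log hlarge).one_div_length_le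
    gcongr
    calc 5787 / ((2 ^ Nat.log 4 k : ℕ) : ℝ) = 5787 * (1 / ((2 ^ Nat.log 4 k : ℕ) : ℝ)) := by ring
      _ ≤ 5787 * (2 * (√k)⁻¹) := by gcongr
      _ ≤ 4 ^ 14 * (√k)⁻¹ := by
          rw [← mul_assoc]
          gcongr
          norm_num

section Final

variable {k s t : ℕ} {F : CNF}

lemma CNF.IsKSCNF.mono (h : CNF.IsKSCNF k s F) (hst : s ≤ t) : CNF.IsKSCNF k t F :=
  ⟨h.1, fun v => (h.2 v).trans hst⟩

lemma satisfiable_of_isKSCNF_zero (hk : 1 ≤ k) (h : CNF.IsKSCNF k 0 F) : CNF.Satisfiable F := by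
  refine ⟨fun _ => true, fun C hC => ?_⟩
  obtain ⟨l, hl⟩ := card_pos.1 (hk.trans_eq (h.1 C hC).symm)
  have hocc := h.2 l.1
  rw [CNF.occurrences, Nat.le_zero, card_eq_zero, filter_eq_empty_iff] at hocc
  exact absurd (mem_image_of_mem _ hl) (hocc hC)

lemma lt_of_mem_noMU1Set (hF : CNF.IsKSCNF k s F) (hMU : CNF.IsMU1 F) (ht : t ∈ noMU1Set k) :
    t < s :=
  not_le.1 fun hst => ht F (hF.mono hst) hMU

lemma satSet_subset_noMU1Set (k : ℕ) : satSet k ⊆ noMU1Set k :=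
  fun _ hs F hF hMU => hMU.1.1 (hs F hF)

lemma zero_mem_satSet (hk : 1 ≤ k) : 0 ∈ satSet k := fun _ => satisfiable_of_isKSCNF_zero hk

lemma bddAbove_noMU1Set (hk : 1 ≤ k) : BddAbove (noMU1Set k) := by
  obtain ⟨F, hF, hMU⟩ := exists_formula_of_realizable_zero hk (realizable_zero_two_pow k)
  exact ⟨2 ^ k, fun t ht => (lt_of_mem_noMU1Set hF hMU ht).le⟩

lemma isGreatest_f (hk : 1 ≤ k) : IsGreatest (satSet k) (f k) := by
  have hbdd := (bddAbove_noMU1Set hk).mono (satSet_subset_noMU1Set k)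
  exact ⟨Nat.sSup_mem ⟨0, zero_mem_satSet hk⟩ hbdd, fun s hs => le_csSup hbdd hs⟩

lemma isGreatest_f₁ (hk : 1 ≤ k) : IsGreatest (noMU1Set k) (f₁ k) := by
  have hbdd := bddAbove_noMU1Set hk
  exact ⟨Nat.sSup_mem ⟨0, satSet_subset_noMU1Set k (zero_mem_satSet hk)⟩ hbdd,
    fun s hs => le_csSup hbdd hs⟩

lemma f_le_f₁ (hk : 1 ≤ k) : f k ≤ f₁ k :=
  (isGreatest_f₁ hk).2 (satSet_subset_noMU1Set k (isGreatest_f hk).1)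

lemma floor_sub_one_le_f (hk : 1 ≤ k) :
    ⌊(2 : ℝ) ^ (k + 1) / (Real.exp 1 * (k : ℝ))⌋ - 1 ≤ (f k : ℤ) := by
  set A : ℝ := 2 ^ (k + 1) / (Real.exp 1 * k) with hA
  rcases le_or_gt (⌊A⌋ - 1) 0 with hneg | hpos
  · exact hneg.trans (Int.natCast_nonneg _)
  obtain ⟨s, hs⟩ := Int.eq_ofNat_of_zero_le hpos.le
  have hs1 : 1 ≤ s := by omega
  have hsA : (s : ℝ) + 1 ≤ A := by
    have := Int.floor_le A
    rw [show ⌊A⌋ = (s : ℤ) + 1 by omega] at this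
    exact_mod_cast this
  have hk0 : (0 : ℝ) < k := by exact_mod_cast hk
  rw [hA, le_div_iff₀ (by positivity)] at hsA
  have hk2 : 2 ≤ k := by
    by_contra! hlt
    obtain rfl : k = 1 := by omega
    have : (1 : ℝ) ≤ s := by exact_mod_cast hs1
    norm_num at hsA
    nlinarith [Real.exp_one_gt_d9]
  rw [hs]
  exact_mod_cast (isGreatest_f hk).2 fun F hF => satisfiable_of_occurrences_le hk2 hs1 hsA hF

lemma sub_two_le_f (hk : 1 ≤ k) :
    (Real.exp 1)⁻¹ * ((2 : ℝ) ^ (k + 1) / k) - 2 ≤ f k := by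
  have hfloor := Int.lt_floor_add_one ((2 : ℝ) ^ (k + 1) / (Real.exp 1 * k))
  have hf : ((⌊(2 : ℝ) ^ (k + 1) / (Real.exp 1 * k)⌋ - 1 : ℤ) : ℝ) ≤ f k := by
    exact_mod_cast floor_sub_one_le_f hk
  rw [Int.cast_sub, Int.cast_one] at hf
  rw [inv_mul_eq_div, div_div, mul_comm (k : ℝ)]
  linarith

lemma sq_le_two_pow_succ (k : ℕ) : k ^ 2 ≤ 2 ^ (k + 1) := by
  rcases lt_or_ge k 10 with hk | hk
  · interval_cases k <;> norm_num
  · have := eight_mul_sq_le_two_pow hk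
    rw [pow_succ 2 k]
    omega

lemma one_le_rpow_mul (hk : 1 ≤ k) :
    1 ≤ (k : ℝ) ^ (-(1 / 2 : ℝ)) * ((2 : ℝ) ^ (k + 1) / k) := by
  have hk1 : (1 : ℝ) ≤ k := by exact_mod_cast hk
  calc (1 : ℝ) ≤ k ^ (-1 : ℝ) * (2 ^ (k + 1) / k) := by
        rw [Real.rpow_neg_one, inv_mul_eq_div, div_div, one_le_div (by positivity), ← sq]
        exact_mod_cast sq_le_two_pow_succ k
    _ ≤ (k : ℝ) ^ (-(1 / 2 : ℝ)) * (2 ^ (k + 1) / k) := by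
        gcongr
        norm_num

lemma abs_sub_le_of_f_le (hk : 1 ≤ k) {g : ℕ} {C : ℝ} (hC : 0 ≤ C) (hfg : f k ≤ g)
    (hg : (g : ℝ) ≤ ((Real.exp 1)⁻¹ + C * (k : ℝ) ^ (-(1 / 2 : ℝ))) * ((2 : ℝ) ^ (k + 1) / k)) :
    |(g : ℝ) - (Real.exp 1)⁻¹ * ((2 : ℝ) ^ (k + 1) / k)| ≤
      (C + 2) * (k : ℝ) ^ (-(1 / 2 : ℝ)) * ((2 : ℝ) ^ (k + 1) / k) := by
  have hlow := sub_two_le_f hk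
  have hfg' : (f k : ℝ) ≤ g := by exact_mod_cast hfg
  have hone := one_le_rpow_mul hk
  have herr := mul_nonneg hC (zero_le_one.trans hone)
  rw [abs_le]
  constructor <;> linarith

lemma isEquivalent_of_abs_sub_le {g B : ℕ → ℝ} {c C : ℝ} (hc : 0 < c) (hB : ∀ k, 0 ≤ B k)
    (h : ∀ k : ℕ, 1 ≤ k → |g k - c * B k| ≤ C * (k : ℝ) ^ (-(1 / 2 : ℝ)) * B k) :
    Asymptotics.IsEquivalent Filter.atTop g fun k => c * B k := by
  have htendsto : Filter.Tendsto (fun k : ℕ => C * (k : ℝ) ^ (-(1 / 2 : ℝ))) Filter.atTop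
      (nhds 0) := by
    simpa using ((tendsto_rpow_neg_atTop (by norm_num : (0 : ℝ) < 1 / 2)).comp
      tendsto_natCast_atTop_atTop).const_mul C
  rw [Asymptotics.IsEquivalent, Asymptotics.isLittleO_iff]
  intro ε hε
  filter_upwards [htendsto.eventually_le_const (show 0 < ε * c by positivity),
    Filter.eventually_ge_atTop 1] with k hsmall hk
  rw [Pi.sub_apply, Real.norm_eq_abs, Real.norm_eq_abs]
  refine (h k hk).trans ?_
  rw [abs_of_nonneg (mul_nonneg hc.le (hB k)), ← mul_assoc]
  exact mul_le_mul_of_nonneg_right hsmall (hB k)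

end Final

lemma exists_asymptotics : ∃ C : ℝ, ∀ k : ℕ, 1 ≤ k →
    |(f k : ℝ) - (Real.exp 1)⁻¹ * ((2 : ℝ) ^ (k + 1) / k)| ≤
        C * (k : ℝ) ^ (-(1 / 2 : ℝ)) * ((2 : ℝ) ^ (k + 1) / k) ∧
      |(f₁ k : ℝ) - (Real.exp 1)⁻¹ * ((2 : ℝ) ^ (k + 1) / k)| ≤
        C * (k : ℝ) ^ (-(1 / 2 : ℝ)) * ((2 : ℝ) ^ (k + 1) / k) ∧
      ∃ (s : ℕ) (F : CNF), CNF.IsKSCNF k s F ∧ CNF.IsMU1 F ∧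
        (s : ℝ) ≤ ((Real.exp 1)⁻¹ + C * (k : ℝ) ^ (-(1 / 2 : ℝ))) * ((2 : ℝ) ^ (k + 1) / k) := by
  obtain ⟨C, hC, hformula⟩ := exists_mu1_formula
  refine ⟨C + 2, fun k hk => ?_⟩
  obtain ⟨s, F, hF, hMU, hs⟩ := hformula k hk
  have hf₁ := le_trans
    (Nat.cast_le.2 (lt_of_mem_noMU1Set hF hMU (isGreatest_f₁ hk).1).le) hs
  have hf := le_trans (Nat.cast_le.2 (f_le_f₁ hk)) hf₁
  refine ⟨abs_sub_le_of_f_le hk hC le_rfl hf, abs_sub_le_of_f_le hk hC (f_le_f₁ hk) hf₁,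
    s, F, hF, hMU, hs.trans ?_⟩
  gcongr
  linarith

end KSat

theorem theorem1 :
    -- the two maxima exist, so that `f` and `f₁` are well defined
    (∀ k : ℕ, 1 ≤ k →
      IsGreatest (KSat.satSet k) (KSat.f k) ∧ IsGreatest (KSat.noMU1Set k) (KSat.f₁ k)) ∧
    -- the lower bound
    (∀ k : ℕ, 1 ≤ k →
      ⌊(2 : ℝ) ^ (k + 1) / (Real.exp 1 * (k : ℝ))⌋ - 1 ≤ (KSat.f k : ℤ)) ∧
    -- the asymptotics, with the upper bound witnessed by formulas in MU(1)
    (∃ C : ℝ, ∀ k : ℕ, 1 ≤ k →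
      |(KSat.f k : ℝ) - (Real.exp 1)⁻¹ * ((2 : ℝ) ^ (k + 1) / (k : ℝ))| ≤
          C * (k : ℝ) ^ (-(1 / 2 : ℝ)) * ((2 : ℝ) ^ (k + 1) / (k : ℝ)) ∧
      ∃ (s : ℕ) (F : KSat.CNF), KSat.CNF.IsKSCNF k s F ∧ KSat.CNF.IsMU1 F ∧
        (s : ℝ) ≤ ((Real.exp 1)⁻¹ + C * (k : ℝ) ^ (-(1 / 2 : ℝ))) *
          ((2 : ℝ) ^ (k + 1) / (k : ℝ))) ∧
    -- `f(k) = (1 + o(1)) f₁(k)`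
    Asymptotics.IsEquivalent Filter.atTop
      (fun k : ℕ => (KSat.f k : ℝ)) (fun k : ℕ => (KSat.f₁ k : ℝ)) := by
  obtain ⟨C, hC⟩ := KSat.exists_asymptotics
  refine ⟨fun k hk => ⟨KSat.isGreatest_f hk, KSat.isGreatest_f₁ hk⟩,
    fun k hk => KSat.floor_sub_one_le_f hk, ⟨C, fun k hk => ⟨(hC k hk).1, (hC k hk).2.2⟩⟩, ?_⟩
  have he : 0 < (Real.exp 1)⁻¹ := by positivity
  have hB : ∀ k : ℕ, (0 : ℝ) ≤ 2 ^ (k + 1) / k := fun k => by positivity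
  exact (KSat.isEquivalent_of_abs_sub_le he hB fun k hk => (hC k hk).1).trans
    (KSat.isEquivalent_of_abs_sub_le he hB fun k hk => (hC k hk).2.1).symm
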